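/- **Setting.** An instance of the eventful bandit problem consists of a number of rounds $T\ge 2$, $n$ arms, click probabilities $p_t(i)\in[0,1]$ ($1\le t\le T$, $1\le i\le n$), contexts $x_1,\dots,x_T\in\mathcal X$ and a set $\mathcal F$ of concepts $f:\mathcal X\to\{-1,+1,\mathtt{null}\}$. An *event* is a round $t\ge 2$ with $p_{t-1}\ne p_t$; $k$ is the number of events. Some $f\in\mathcal F$ is an *event oracle*: for $2\le t\le T$, $f(x_t)=+1$ if $t$ is an event and $f(x_t)=-1$ otherwise. Write $p_t^*=\max_i p_t(i)$. The minimum shift $\varepsilon_S>0$ is such that at every event $t$ some arm $i$ with $p_{t-1}(i)=p^*_{t-1}$ has $p_t(i)<p_t^*-\varepsilon_S$. The minimum suboptimality $\Delta>0$ is such that $p_t^*-p_t(i)\ge\Delta$ whenever $p_t(i)<p_t^*$. The *diameter* $d_{\mathcal F}$ is the length of the longest sequence $y_1,\dots,y_m\in\mathcal X$ such that for each $r\le m$ there is $f\in\mathcal F$ with $f(y_r)=+1$ and $f(y_s)=-1$ for all $s<r$; assume $1\le d_{\mathcal F}<\infty$. In round $t$ the algorithm sees $x_t$, chooses an arm $i_t$,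 and then observes a click, which occurs with probability $p_t(i_t)$. The regret is $R(T)=E\big[\sum_{t=1}^T(p_t^*-p_t(i_t))\big]$. **Classifier SafeCl.** It predicts "positive" on $x$ iff some $f\in\mathcal F$ has $f(x)=+1$ and $f(x')=-1$ for every $\mathtt{false}$-labeled example $x'$ received so far. **Bandit (modified $\mathrm{UCB1}(6,T)$).** In round $t$ of a run it plays an arm $u$ maximizing $\mu(u)+12\sqrt{2\log(t+T)/(1+n(u))}$, where $n(u)$ is the number of plays of $u$ and $\mu(u)$ the fraction of these that were clicked (0 if $n(u)=0$), both within the run. After round $t$ let $v^*$ be an arm played most often in the last $\lceil t/2\rceil$ rounds and $\widehat\Delta(v)=\mu(v^*)-\mu(v)$; the $t$-th round guess is $G^+=\{v:\widehat\Delta(v)\le\varepsilon_S/4\}$, $G^-=\{v:\widehat\Delta(v)>\varepsilon_S/2\}$. All ties are broken arbitrarily. **Meta-algorithm BWC with parameter $L\in\mathbb N$.** Phases $j=1,2,\dots$ alternate between *testing* (odd $j$) and *adapting* (even $j$); each starts a fresh run of the bandit, which chooses the arms in that phase. Let $t_j$ be the first round of phase $j$ ($t_1=1$). A testing phase lasts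 $L$ rounds. In each round $t$ of an adapting phase, before an arm is chosen, $x_t$ is passed to the classifier; if it predicts "positive", the adapting phase ends (without round $t$, so it may be empty) and the next testing phase starts in round $t$. A phase is *full* if it lasts at least $L$ rounds, and $(G_j^+,G_j^-)$ denotes the $L$-th round guess in a full phase $j$. At the end of a testing phase $j$, if there is a full phase before it, let $i$ be the most recent one; if $G_i^+\cap G_j^-=\emptyset$, the example $(x_{t_j},\mathtt{false})$ is passed to the classifier. No other examples are passed to it. **Theorem.** There is an absolute constant $c_0>0$ such that for every $c_1\ge c_0$ there is a constant $C>0$, depending only on $c_1$, with the following property. For every instance as above and every $L\in\mathbb N$ with $$c_0\,\frac{n}{\varepsilon_S^2}\log T\;\le\; L\;\le\; c_1\,\frac{n}{\varepsilon_S^2}\log T$$ such that any two events are at least $2L$ rounds apart, the regret of BWC with parameter $L$, classifier SafeCl and the modified $\mathrm{UCB1}(6,T)$ bandit satisfies $$R_{\mathrm{BWC}}(T)\;\le\; C\left((3k+2d_{\mathcal F})\frac n\Delta+k\,\frac n{\varepsilon_S^2}\right)\log T .$$ -/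

import Mathlib

namespace EventfulBandit

/-! ## The eventful bandit problem

Rounds are `1, …, T`, arms are `Fin n`; `p t i` is the click probability of arm `i` in round `t`
and `x t` is the context revealed at the start of round `t`. -/

/-- Values of a concept: `-1`, `+1`, or `null` (an infeasible context). -/
inductive Value
  | neg
  | pos
  | null

/-- The largest click probability in round `t`. -/
noncomputable def best {n : ℕ} (p : ℕ → Fin n → ℝ) (t : ℕ) : ℝ := ⨆ i, p t i

open Classical in
/-- The events: the rounds `2 ≤ t ≤ T` with `p_{t-1} ≠ p_t`. -/
noncomputable def events {n : ℕ} (p : ℕ → Fin n → ℝ) (T : ℕ) : Finset ℕ :=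
  (Finset.Icc 2 T).filter fun t => p (t - 1) ≠ p t

/-- Any two events are at least `m` rounds apart. -/
def EventsApart {n : ℕ} (p : ℕ → Fin n → ℝ) (T m : ℕ) : Prop :=
  ∀ s ∈ events p T, ∀ t ∈ events p T, s < t → s + m ≤ t

/-- Minimum shift `ε`: at every event, some arm that was optimal just before the event
is more than `ε` below the optimum right after it. -/
def HasMinShift {n : ℕ} (p : ℕ → Fin n → ℝ) (T : ℕ) (ε : ℝ) : Prop :=
  ∀ t ∈ events p T, ∃ i, p (t - 1) i = best p (t - 1) ∧ p t i < best p t - ε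

/-- Minimum suboptimality `Δ`: in every round, every suboptimal arm is at least `Δ` below the
optimum. -/
def HasMinSubopt {n : ℕ} (p : ℕ → Fin n → ℝ) (T : ℕ) (Δ : ℝ) : Prop :=
  ∀ t ∈ Finset.Icc 1 T, ∀ i, p t i < best p t → Δ ≤ best p t - p t i

/-- `f` is an event oracle: `+1` on the contexts of events, `-1` on those of all other rounds.
(Whether round `1` is an event is meaningless, so its context is unconstrained.) -/
def IsEventOracle {n : ℕ} {X : Type*} (p : ℕ → Fin n → ℝ) (x : ℕ → X) (T : ℕ)
    (f : X → Value) : Prop :=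
  ∀ t ∈ Finset.Icc 2 T,
    (t ∈ events p T → f (x t) = Value.pos) ∧ (t ∉ events p T → f (x t) = Value.neg)

/-- The diameter of a concept class: the largest length of a sequence of contexts such that for each
of its members some concept is `+1` there and `-1` on all earlier members. -/
noncomputable def diameter {X : Type*} (F : Set (X → Value)) : ℕ∞ :=
  sSup {d : ℕ∞ | ∃ m : ℕ, d = m ∧ ∃ y : Fin m → X, ∀ t, ∃ f ∈ F,
    f (y t) = Value.pos ∧ ∀ s < t, f (y s) = Value.neg}

/-! ## The two components and the classifier -/

/-- A classifier: given the labeled samples received so far and an unlabeled context, it predicts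
"positive" or not. -/
structure Classifier (X : Type*) where
  positive : List (X × Bool) → X → Prop

/-- `SafeCl`: `x` is classified as negative iff no concept is `+1` at `x` and `-1` at each
`false`-labeled sample received so far. -/
def safeCl {X : Type*} (F : Set (X → Value)) : Classifier X where
  positive S x := ∃ f ∈ F, f x = Value.pos ∧ ∀ x', (x', false) ∈ S → f x' = Value.neg

/-- A bandit algorithm with guesses. A history is the list, in chronological order, of the arms
played and the clicks observed since the start of the run. `arm h` is the arm played next, and
`guess h` is the pair `(G⁺, G⁻)` formed after the rounds in `h`. -/
structure Bandit (n : ℕ) where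
  arm : List (Fin n × Bool) → Fin n
  guess : List (Fin n × Bool) → Finset (Fin n) × Finset (Fin n)

/-! ## The modified UCB1 -/

/-- Number of times that arm `u` was played. -/
def plays {n : ℕ} (h : List (Fin n × Bool)) (u : Fin n) : ℕ :=
  h.countP fun a => a.1 = u

/-- Number of clicks on arm `u`. -/
def clicks {n : ℕ} (h : List (Fin n × Bool)) (u : Fin n) : ℕ :=
  h.countP fun a => a = (u, true)

/-- Sample average of arm `u`; it is `0` as long as `u` has not been played. -/
noncomputable def mean {n : ℕ} (h : List (Fin n × Bool)) (u : Fin n) : ℝ :=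
  (clicks h u : ℝ) / (plays h u : ℝ)

/-- The index of arm `u` in round `t = h.length + 1` of the run. -/
noncomputable def index {n : ℕ} (T : ℕ) (h : List (Fin n × Bool)) (u : Fin n) : ℝ :=
  mean h u + 12 * √(2 * Real.log (((h.length + 1 : ℕ) : ℝ) + T) / (1 + (plays h u : ℝ)))

open Classical in
/-- The set of maximizers of a function of the arms. -/
noncomputable def argmaxSet {n : ℕ} {R : Type*} [LinearOrder R] (g : Fin n → R) :
    Finset (Fin n) :=
  Finset.univ.filter fun u => ∀ v, g v ≤ g u

/-- An arbitrary, possibly history-dependent, way to break ties: `arm` among the arms of maximal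
index, `star` among the arms played most often in the second half of the run. -/
structure TieBreak (n : ℕ) where
  arm : List (Fin n × Bool) → Finset (Fin n) → Fin n
  star : List (Fin n × Bool) → Finset (Fin n) → Fin n
  arm_mem : ∀ h s, s.Nonempty → arm h s ∈ s
  star_mem : ∀ h s, s.Nonempty → star h s ∈ s

/-- The arm `v*` played most often in the last `t / 2` of the `t = h.length` rounds. -/
noncomputable def starArm {n : ℕ} (tie : TieBreak n) (h : List (Fin n × Bool)) : Fin n :=
  tie.star h (argmaxSet (plays (h.drop (h.length / 2))))

/-- The estimate of the suboptimality of arm `v`. -/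
noncomputable def gapEst {n : ℕ} (tie : TieBreak n) (h : List (Fin n × Bool)) (v : Fin n) : ℝ :=
  mean h (starArm tie h) - mean h v

open Classical in
/-- The modified bandit algorithm `UCB1(6, T)` with its guesses, for the parameter `ε`. -/
noncomputable def ucb {n : ℕ} (T : ℕ) (ε : ℝ) (tie : TieBreak n) : Bandit n where
  arm h := tie.arm h (argmaxSet (index T h))
  guess h :=
    (Finset.univ.filter fun v => gapEst tie h v ≤ ε / 4,
     Finset.univ.filter fun v => ε / 2 < gapEst tie h v)

/-! ## The meta-algorithm `BWC` (bandit with classifier) -/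

/-- The state of `BWC` between rounds. -/
structure State (X : Type*) (n : ℕ) where
  /-- is the current phase a testing phase (otherwise it is an adapting phase)? -/
  testing : Bool
  /-- the first round of the current phase -/
  start : ℕ
  /-- the history of the current phase, which is all that the current run of the bandit sees -/
  hist : List (Fin n × Bool)
  /-- the set `G⁺` of the most recent full phase before the current one, if there is one -/
  lastPlus : Option (Finset (Fin n))
  /-- the labeled samples passed to the classifier so far -/
  samples : List (X × Bool)

/-- `BWC` starts with a testing phase in round `1`. -/
def State.init (X : Type*) (n : ℕ) : State X n where
  testing := true
  start := 1
  hist := []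
  lastPlus := none
  samples := []

open Classical in
/-- What happens in round `t` before an arm is chosen. In an adapting phase the context `x t` is
passed to the classifier; on a positive prediction the adapting phase ends (it comprises the rounds
before `t`, and its `L`-th round guess is kept if it lasted for at least `L` rounds) and a testing
phase with first round `t` begins. `B s` is the run of the bandit that is started in round `s`. -/
noncomputable def State.startRound {X : Type*} {n : ℕ} (L : ℕ) (B : ℕ → Bandit n)
    (K : Classifier X) (x : ℕ → X) (t : ℕ) (s : State X n) : State X n :=
  if s.testing = false ∧ K.positive s.samples (x t) then
    { testing := true
      start := t
      hist := []
      lastPlus :=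
        if L ≤ s.hist.length then some ((B s.start).guess (s.hist.take L)).1 else s.lastPlus
      samples := s.samples }
  else s

/-- The arm chosen in the current round, once `startRound` has taken place. -/
def State.arm {X : Type*} {n : ℕ} (B : ℕ → Bandit n) (s : State X n) : Fin n :=
  (B s.start).arm s.hist

open Classical in
/-- What happens in round `t` once it is known whether the chosen arm was clicked. The bandit is
updated. If this was the `L`-th round of a testing phase then the phase ends: the context of
its first round is labeled `false`, and passed to the classifier, iff `G⁺ ∩ G⁻ = ∅`, where `G⁺`
is that of the most recent full phase before (no sample is passed if there is none) and `G⁻` is that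
of the phase that has just ended. An adapting phase begins in round `t + 1`. -/
noncomputable def State.endRound {X : Type*} {n : ℕ} (L : ℕ) (B : ℕ → Bandit n)
    (x : ℕ → X) (t : ℕ) (click : Bool) (s : State X n) : State X n :=
  let h := s.hist ++ [(s.arm B, click)]
  if s.testing = true ∧ h.length = L then
    { testing := false
      start := t + 1
      hist := []
      lastPlus := some ((B s.start).guess h).1
      samples :=
        if ∃ G, s.lastPlus = some G ∧ G ∩ ((B s.start).guess h).2 = ∅ then
          (x s.start, false) :: s.samples
        else s.samples }
  else { s with hist := h }

/-- The state of `BWC` after `t` rounds, when `ω` is the set of the rounds with a click. -/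
noncomputable def run {X : Type*} {n : ℕ} (L : ℕ) (B : ℕ → Bandit n) (K : Classifier X)
    (x : ℕ → X) (ω : Finset ℕ) : ℕ → State X n
  | 0 => State.init X n
  | t + 1 => ((run L B K x ω t).startRound L B K x (t + 1)).endRound L B x (t + 1)
      (decide (t + 1 ∈ ω))

/-- The arm chosen by `BWC` in round `t ≥ 1`; it depends on `ω` only through the rounds
before `t`. -/
noncomputable def armAt {X : Type*} {n : ℕ} (L : ℕ) (B : ℕ → Bandit n) (K : Classifier X)
    (x : ℕ → X) (ω : Finset ℕ) (t : ℕ) : Fin n :=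
  ((run L B K x ω (t - 1)).startRound L B K x t).arm B

/-- The probability that `ω` is the set of the rounds with a click, each chosen arm `i_t`
being clicked with probability `p t i_t`. -/
noncomputable def prob {X : Type*} {n : ℕ} (L : ℕ) (B : ℕ → Bandit n) (K : Classifier X)
    (x : ℕ → X) (p : ℕ → Fin n → ℝ) (T : ℕ) (ω : Finset ℕ) : ℝ :=
  ∏ t ∈ Finset.Icc 1 T,
    if t ∈ ω then p t (armAt L B K x ω t) else 1 - p t (armAt L B K x ω t)

/-- The regret of `BWC`: the expectation, over the set `ω` of the rounds with a click, of
`∑_{t=1}^T (max_i p_t(i) - p_t(i_t))`. -/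
noncomputable def regret {X : Type*} {n : ℕ} (L : ℕ) (B : ℕ → Bandit n) (K : Classifier X)
    (x : ℕ → X) (p : ℕ → Fin n → ℝ) (T : ℕ) : ℝ :=
  ∑ ω ∈ (Finset.Icc 1 T).powerset, prob L B K x p T ω *
    ∑ t ∈ Finset.Icc 1 T, (best p t - p t (armAt L B K x ω t))

end EventfulBandit

universe u

/-! The argument splits into a probabilistic and a deterministic half. With `Concentrated`, the
clicks on every arm over every stretch of rounds stay within the radius `rad` of their expectation;
all stretches are needed because the runs start at random rounds. Hoeffding's exponential
supermartingale and a union bound give the complement probability at most 2nT³/T⁸, so for n ≤ T it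
adds at most 1 to the regret (`regret_le`). Everything else holds for each concentrated click
sequence.

In a run without events UCB1 plays an arm O(log T / gap²) times, which bounds the regret of the run
by A = `phaseRegret`. After L rounds the guesses are correct up to constants
(`IsRun.accurateGuess`): optimal arms lie in G⁺, arms with gap above ε lie in G⁻, and the gap 3ε/8
separates G⁺ from G⁻. Hence G⁺ of one phase and G⁻ of a later one are disjoint if nothing changed,
but share an arm if the later phase starts at an event that is the only change. So only non-events
are ever labeled `false`. The event oracle stays consistent with the samples, and SafeCl detects
every event of an adapting phase. Each sample was a false positive, so the samples form a sequence
as in the definition of the diameter, and there are at most d of them.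

A completed testing phase yields a sample unless it is the first one, or an event falls into it or
into the full phase it is compared with; the latter is then a testing phase as well, since adapting
phases are free of events. Each event thus excuses at most two testing phases, so at most 1 + d + 2k
are completed. Each costs 2A together with the adapting phase after it, and each event costs at most
L more. `Invariant` carries this bookkeeping from round to round. -/

namespace EventfulBandit

/-! ### Histories of stretches of rounds -/

section Segment

variable {n : ℕ} (arm : ℕ → Fin n) (click : ℕ → Bool)

/-- The history of the rounds `a ≤ r < b`. -/
def segment (a b : ℕ) : List (Fin n × Bool) :=
  (List.range' a (b - a)).map fun r => (arm r, click r)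

@[simp] lemma length_segment (a b : ℕ) : (segment arm click a b).length = b - a := by
  simp [segment]

@[simp] lemma segment_self (a : ℕ) : segment arm click a a = [] := by
  simp [segment]

lemma segment_succ {a b : ℕ} (h : a ≤ b) :
    segment arm click a (b + 1) = segment arm click a b ++ [(arm b, click b)] := by
  unfold segment
  rw [Nat.succ_sub h, Nat.succ_eq_add_one, List.range'_1_concat, List.map_append]
  simp [Nat.add_sub_cancel' h]

lemma take_segment {a b L : ℕ} (h : a + L ≤ b) :
    (segment arm click a b).take L = segment arm click a (a + L) := by
  unfold segment
  rw [← List.map_take, List.take_range'_of_length_ge (by omega)]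
  simp

lemma drop_segment (a b j : ℕ) :
    (segment arm click a b).drop j = segment arm click (a + j) b := by
  unfold segment
  rw [← List.map_drop, List.drop_range', Nat.mul_one, Nat.sub_sub]

lemma plays_segment_succ {a b : ℕ} (h : a ≤ b) (u : Fin n) :
    plays (segment arm click a (b + 1)) u =
      plays (segment arm click a b) u + if arm b = u then 1 else 0 := by
  rw [segment_succ _ _ h, plays, List.countP_append]
  simp [plays, List.countP_cons]

lemma plays_segment_eq_sum {a b : ℕ} (h : a ≤ b) (u : Fin n) :
    plays (segment arm click a b) u = ∑ r ∈ Finset.Ico a b, if arm r = u then 1 else 0 := by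
  induction b, h using Nat.le_induction with
  | base => simp [plays]
  | succ b h ih => rw [plays_segment_succ _ _ h, ih, Finset.sum_Ico_succ_top h]

lemma clicks_segment_eq_sum {a b : ℕ} (h : a ≤ b) (u : Fin n) :
    clicks (segment arm click a b) u =
      ∑ r ∈ Finset.Ico a b, if arm r = u then (if click r then 1 else 0) else 0 := by
  induction b, h using Nat.le_induction with
  | base => simp [clicks]
  | succ b h ih =>
    rw [segment_succ _ _ h, clicks, List.countP_append, ← clicks, ih, Finset.sum_Ico_succ_top h]
    by_cases h1 : arm b = u <;> by_cases h2 : click b <;> simp [h1, h2]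

lemma plays_segment_le {a b c : ℕ} (h : a ≤ b) (h' : b ≤ c) (u : Fin n) :
    plays (segment arm click a b) u ≤ plays (segment arm click a c) u := by
  rw [plays_segment_eq_sum _ _ h, plays_segment_eq_sum _ _ (h.trans h')]
  exact Finset.sum_le_sum_of_subset (Finset.Ico_subset_Ico_right h')

lemma plays_segment_le_left {a b c : ℕ} (h : a ≤ b) (h' : b ≤ c) (u : Fin n) :
    plays (segment arm click b c) u ≤ plays (segment arm click a c) u := by
  rw [plays_segment_eq_sum _ _ h', plays_segment_eq_sum _ _ (h.trans h')]
  exact Finset.sum_le_sum_of_subset (Finset.Ico_subset_Ico_left h)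

lemma plays_segment_le_length {a b : ℕ} (u : Fin n) :
    plays (segment arm click a b) u ≤ b - a := by
  simpa [plays] using List.countP_le_length (p := fun c : Fin n × Bool => decide (c.1 = u))
    (l := segment arm click a b)

lemma sum_Ico_comp_arm {a b : ℕ} (h : a ≤ b) (g : Fin n → ℝ) :
    ∑ r ∈ Finset.Ico a b, g (arm r) = ∑ u, (plays (segment arm click a b) u : ℝ) * g u := by
  simp_rw [plays_segment_eq_sum _ _ h, Nat.cast_sum, Finset.sum_mul]
  rw [Finset.sum_comm]
  refine Finset.sum_congr rfl fun r _ => ?_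
  simp

lemma sum_plays_segment {a b : ℕ} (h : a ≤ b) :
    ∑ u, (plays (segment arm click a b) u : ℝ) = (b : ℝ) - a := by
  have := sum_Ico_comp_arm arm click h fun _ => 1
  simp only [mul_one, Finset.sum_const, Nat.card_Ico, nsmul_eq_mul] at this
  rw [← this, Nat.cast_sub h]

/-- The last round in which an arm was played. -/
lemma exists_last_play {a b : ℕ} (h : a ≤ b) {u : Fin n}
    (hu : plays (segment arm click a b) u ≠ 0) :
    ∃ r, a ≤ r ∧ r < b ∧ arm r = u ∧
      plays (segment arm click a b) u = plays (segment arm click a r) u + 1 := by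
  induction b, h using Nat.le_induction with
  | base => simp [plays] at hu
  | succ b h ih =>
    by_cases hb : arm b = u
    · exact ⟨b, h, b.lt_succ_self, hb, by simp [plays_segment_succ _ _ h, hb]⟩
    · rw [plays_segment_succ _ _ h, if_neg hb, add_zero] at hu ⊢
      obtain ⟨r, h1, h2, h3, h4⟩ := ih hu
      exact ⟨r, h1, h2.trans b.lt_succ_self, h3, h4⟩

end Segment

/-! ### Confidence radii and concentration -/

/-- The confidence radius of an arm that was played `m` times. -/
noncomputable def rad (T m : ℕ) : ℝ := 2 * √(2 * Real.log T / (1 + m))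

lemma rad_nonneg (T m : ℕ) : 0 ≤ rad T m := by unfold rad; positivity

lemma rad_anti (T : ℕ) {m m' : ℕ} (h : m ≤ m') : rad T m' ≤ rad T m := by
  have : 0 ≤ Real.log T := Real.log_natCast_nonneg T
  unfold rad
  gcongr

lemma rad_sq (T m : ℕ) : (1 + m) * rad T m ^ 2 = 8 * Real.log T := by
  have : 0 ≤ Real.log T := Real.log_natCast_nonneg T
  unfold rad
  rw [mul_pow, Real.sq_sqrt (by positivity)]
  field_simp
  ring

lemma half_lt_log {T : ℕ} (hT : 2 ≤ T) : 1 / 2 < Real.log T := by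
  have h := Real.log_two_gt_d9
  have : Real.log 2 ≤ Real.log T := Real.log_le_log (by norm_num) (by exact_mod_cast hT)
  linarith

lemma one_le_rad_zero {T : ℕ} (hT : 2 ≤ T) : 1 ≤ rad T 0 := by
  have h := rad_sq T 0
  have := half_lt_log hT
  simp only [Nat.cast_zero, add_zero, one_mul] at h
  nlinarith [rad_nonneg T 0]

/-- On each stretch of rounds, the number of clicks on an arm is close to its expectation. -/
def Concentrated {n : ℕ} (p : ℕ → Fin n → ℝ) (T : ℕ) (arm : ℕ → Fin n) (click : ℕ → Bool) :
    Prop :=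
  ∀ a b u, 1 ≤ a → a ≤ b → b ≤ T + 1 →
    |(clicks (segment arm click a b) u : ℝ) -
        ∑ r ∈ Finset.Ico a b, if arm r = u then p r u else 0| ≤
      plays (segment arm click a b) u * rad T (plays (segment arm click a b) u)

/-- The rounds `a ≤ r < b` are played by one run of a bandit. -/
def IsRun {n : ℕ} (B : Bandit n) (arm : ℕ → Fin n) (click : ℕ → Bool) (a b : ℕ) : Prop :=
  ∀ r, a ≤ r → r < b → arm r = B.arm (segment arm click a r)

lemma IsRun.mono {n : ℕ} {B : Bandit n} {arm : ℕ → Fin n} {click : ℕ → Bool} {a b c : ℕ}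
    (h : IsRun B arm click a c) (hbc : b ≤ c) : IsRun B arm click a b :=
  fun r h1 h2 => h r h1 (h2.trans_le hbc)

/-! ### UCB1 on concentrated clicks without events -/

section Index

variable {n T : ℕ} {p : ℕ → Fin n → ℝ} {q : Fin n → ℝ} {arm : ℕ → Fin n} {click : ℕ → Bool}
  {a b : ℕ}

lemma abs_mean_sub_le (hc : Concentrated p T arm click) (hT : 2 ≤ T) (ha : 1 ≤ a) (hab : a ≤ b)
    (hb : b ≤ T + 1) (hq : ∀ u, 0 ≤ q u ∧ q u ≤ 1) (hpq : ∀ r, a ≤ r → r < b → p r = q)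
    (u : Fin n) :
    |mean (segment arm click a b) u - q u| ≤ rad T (plays (segment arm click a b) u) := by
  have h := hc a b u ha hab hb
  have hs : ∑ r ∈ Finset.Ico a b, (if arm r = u then p r u else 0) =
      plays (segment arm click a b) u * q u := by
    rw [plays_segment_eq_sum _ _ hab, Nat.cast_sum, Finset.sum_mul]
    refine Finset.sum_congr rfl fun r hr => ?_
    rw [Finset.mem_Ico] at hr
    rw [hpq r hr.1 hr.2]
    simp
  rw [hs] at h
  unfold mean
  generalize plays (segment arm click a b) u = m at *
  rcases Nat.eq_zero_or_pos m with rfl | hm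
  -- An unplayed arm has the default mean 0, which is within 1 ≤ `rad T 0` of any probability.
  · have := one_le_rad_zero hT
    rw [Nat.cast_zero, div_zero, zero_sub, abs_neg, abs_of_nonneg (hq u).1]
    linarith [(hq u).2]
  · have hm' : (0 : ℝ) < m := by exact_mod_cast hm
    rw [show (clicks (segment arm click a b) u : ℝ) / m - q u =
      (clicks (segment arm click a b) u - m * q u) / m by field_simp, abs_div, abs_of_pos hm',
      div_le_iff₀ hm', mul_comm (rad T m)]
    exact h

/-- The bonus with log T in place of log(t + T) is exactly 6 `rad`. Since T ≤ t + T ≤ T², the true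
logarithm is at most doubled, and √2 ≤ 3/2 turns 6 into 9. -/
lemma index_mem_Icc (hT : 2 ≤ T) {h : List (Fin n × Bool)} (hh : h.length < T) (u : Fin n) :
    index T h u ∈ Set.Icc (mean h u + 6 * rad T (plays h u)) (mean h u + 9 * rad T (plays h u)) := by
  have hT0 : (0 : ℝ) < T := by exact_mod_cast (by omega : 0 < T)
  have hl : 0 < Real.log T := by linarith [half_lt_log hT]
  have h1 : Real.log T ≤ Real.log (((h.length + 1 : ℕ) : ℝ) + T) :=
    Real.log_le_log hT0 (by simp; positivity)
  have h2 : Real.log (((h.length + 1 : ℕ) : ℝ) + T) ≤ 2 * Real.log T := by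
    have h3 : ((h.length + 1 : ℕ) : ℝ) ≤ T := by exact_mod_cast hh
    have h4 : (2 : ℝ) ≤ T := by exact_mod_cast hT
    rw [show 2 * Real.log T = Real.log ((T : ℝ) ^ 2) by simp]
    exact Real.log_le_log (by positivity) (by nlinarith)
  have hd : (0 : ℝ) < 1 + plays h u := by positivity
  unfold index rad
  constructor
  · have : √(2 * Real.log T / (1 + (plays h u : ℝ))) ≤
        √(2 * Real.log (((h.length + 1 : ℕ) : ℝ) + T) / (1 + (plays h u : ℝ))) := by gcongr
    linarith
  · have : √(2 * Real.log (((h.length + 1 : ℕ) : ℝ) + T) / (1 + (plays h u : ℝ))) ≤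
        3 / 2 * √(2 * Real.log T / (1 + (plays h u : ℝ))) := by
      rw [Real.sqrt_le_left (by positivity), mul_pow, Real.sq_sqrt (by positivity)]
      rw [mul_div_assoc', div_le_div_iff_of_pos_right hd]
      linarith
    linarith

lemma argmaxSet_nonempty [Nonempty (Fin n)] {R : Type*} [LinearOrder R] (g : Fin n → R) :
    (argmaxSet g).Nonempty := by
  obtain ⟨u, hu⟩ := Finite.exists_max g
  exact ⟨u, by simpa [argmaxSet] using hu⟩

variable {ε : ℝ} {tie : TieBreak n}

/-- The index of the arm that is played is maximal. -/
lemma IsRun.index_le (hr : IsRun (ucb T ε tie) arm click a b)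
    (hc : Concentrated p T arm click) (hT : 2 ≤ T) (ha : 1 ≤ a)
    (hb : b ≤ T + 1) (hq : ∀ u, 0 ≤ q u ∧ q u ≤ 1) (hpq : ∀ r, a ≤ r → r < b → p r = q)
    {r : ℕ} (h1 : a ≤ r) (h2 : r < b) (w : Fin n) :
    q w + 5 * rad T (plays (segment arm click a r) w) ≤
      q (arm r) + 10 * rad T (plays (segment arm click a r) (arm r)) := by
  have hne : Nonempty (Fin n) := ⟨arm r⟩
  have hmem : arm r ∈ argmaxSet (index T (segment arm click a r)) := by
    rw [hr r h1 h2]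
    exact tie.arm_mem _ _ (argmaxSet_nonempty _)
  have hle : index T (segment arm click a r) w ≤ index T (segment arm click a r) (arm r) := by
    simp only [argmaxSet, Finset.mem_filter, Finset.mem_univ, true_and] at hmem
    exact hmem w
  have hlen : (segment arm click a r).length < T := by
    rw [length_segment]; omega
  have i1 := (index_mem_Icc hT hlen w).1
  have i2 := (index_mem_Icc hT hlen (arm r)).2
  have hpq' : ∀ s, a ≤ s → s < r → p s = q := fun s h h' => hpq s h (h'.trans h2)
  have m1 := abs_le.1 (abs_mean_sub_le hc hT ha h1 (by omega) hq hpq' w)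
  have m2 := abs_le.1 (abs_mean_sub_le hc hT ha h1 (by omega) hq hpq' (arm r))
  -- Passing from means to probabilities costs one radius on each side: 5 = 6 - 1 and 10 = 9 + 1.
  linarith [m1.1, m2.2]

/-- When `u` was played for the last time, after m earlier plays, its index beat that of `w`, so the
gap is at most 10 `rad T m`; and (m + 1) · 100 `rad`² = 800 log T. -/
lemma IsRun.plays_mul_gap_sq_le (hr : IsRun (ucb T ε tie) arm click a b)
    (hc : Concentrated p T arm click) (hT : 2 ≤ T) (ha : 1 ≤ a) (hab : a ≤ b)
    (hb : b ≤ T + 1) (hq : ∀ u, 0 ≤ q u ∧ q u ≤ 1) (hpq : ∀ r, a ≤ r → r < b → p r = q)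
    {u w : Fin n} (huw : q u ≤ q w) :
    plays (segment arm click a b) u * (q w - q u) ^ 2 ≤ 800 * Real.log T := by
  by_cases h0 : plays (segment arm click a b) u = 0
  · have : 0 ≤ Real.log T := Real.log_natCast_nonneg T
    simp only [h0, Nat.cast_zero, zero_mul]
    linarith
  obtain ⟨r, h1, h2, rfl, h4⟩ := exists_last_play arm click hab h0
  have h := hr.index_le hc hT ha hb hq hpq h1 h2 w
  have hs := rad_sq T (plays (segment arm click a r) (arm r))
  have hw := rad_nonneg T (plays (segment arm click a r) w)
  rw [h4]
  generalize plays (segment arm click a r) (arm r) = m at *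
  have h5 : (q w - q (arm r)) ^ 2 ≤ (10 * rad T m) ^ 2 :=
    pow_le_pow_left₀ (by linarith) (by linarith) 2
  push_cast
  nlinarith [(Nat.cast_nonneg m : (0 : ℝ) ≤ m)]

/-- If the radius of an arm is still large compared to its gap, then the run is short. -/
lemma IsRun.length_mul_rad_sq_le (hr : IsRun (ucb T ε tie) arm click a b)
    (hc : Concentrated p T arm click) (hT : 2 ≤ T) (ha : 1 ≤ a) (hab : a ≤ b)
    (hb : b ≤ T + 1) (hq : ∀ u, 0 ≤ q u ∧ q u ≤ 1) (hpq : ∀ r, a ≤ r → r < b → p r = q)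
    {v w : Fin n} (hw : ∀ u, q u ≤ q w)
    (hv : q w - q v < 9 / 2 * rad T (plays (segment arm click a b) v)) :
    ((b : ℝ) - a) * rad T (plays (segment arm click a b) v) ^ 2 ≤ 3200 * n * Real.log T := by
  have hl : 0 ≤ Real.log T := Real.log_natCast_nonneg T
  have key : ∀ u, plays (segment arm click a b) u *
      rad T (plays (segment arm click a b) v) ^ 2 ≤ 3200 * Real.log T := by
    intro u
    by_cases h0 : plays (segment arm click a b) u = 0
    · simp only [h0, Nat.cast_zero, zero_mul]
      linarith
    obtain ⟨r, h1, h2, rfl, h4⟩ := exists_last_play arm click hab h0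
    have h := hr.index_le hc hT ha hb hq hpq h1 h2 v
    have hs := rad_sq T (plays (segment arm click a r) (arm r))
    have hm := rad_anti T (plays_segment_le arm click h1 h2.le v)
    have hu := hw (arm r)
    rw [h4]
    generalize plays (segment arm click a r) (arm r) = m at *
    -- When `u` was last played, the index of `v` exceeded the optimum by at least (5 - 9/2) radii
    -- of `v`, which `u` could only match if 10 of its own radii made up for it. Hence the factor
    -- 20, and 400 · 8 = 3200.
    have h5 : rad T (plays (segment arm click a b) v) ^ 2 ≤ (20 * rad T m) ^ 2 :=
      pow_le_pow_left₀ (rad_nonneg _ _) (by linarith) 2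
    push_cast
    nlinarith [(Nat.cast_nonneg m : (0 : ℝ) ≤ m)]
  rw [← sum_plays_segment arm click hab, Finset.sum_mul]
  calc _ ≤ ∑ _u : Fin n, 3200 * Real.log T := Finset.sum_le_sum fun u _ => key u
    _ = _ := by simp; ring

end Index

/-! ### Regret and guesses of a run without events -/

section Best

variable {n : ℕ} {p : ℕ → Fin n → ℝ}

lemma le_best (t : ℕ) (u : Fin n) : p t u ≤ best p t :=
  le_ciSup (Set.finite_range (p t)).bddAbove u

lemma exists_eq_best [Nonempty (Fin n)] (p : ℕ → Fin n → ℝ) (t : ℕ) :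
    ∃ w, p t w = best p t :=
  exists_eq_ciSup_of_finite

lemma best_congr {s t : ℕ} (h : p s = p t) : best p s = best p t := by
  unfold best; rw [h]

/-- The guess formed from a stretch of rounds that starts in round `a` is accurate. -/
structure AccurateGuess (p : ℕ → Fin n → ℝ) (ε : ℝ) (a : ℕ)
    (G : Finset (Fin n) × Finset (Fin n)) : Prop where
  mem_plus : ∀ v, p a v = best p a → v ∈ G.1
  gap_le : ∀ v ∈ G.1, best p a - p a v ≤ 3 / 8 * ε
  mem_minus : ∀ v, ε < best p a - p a v → v ∈ G.2
  lt_gap : ∀ v ∈ G.2, 3 / 8 * ε < best p a - p a v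

variable {T : ℕ} {arm : ℕ → Fin n} {click : ℕ → Bool} {a b : ℕ} {ε : ℝ} {tie : TieBreak n}

/-- An arm contributes plays · gap. As plays · gap² ≤ 800 log T, dividing by gap ≥ Δ bounds this by
800 log T / Δ. -/
lemma IsRun.sum_gap_le {Δ : ℝ} (hr : IsRun (ucb T ε tie) arm click a b)
    (hc : Concentrated p T arm click) (hT : 2 ≤ T) (ha : 1 ≤ a)
    (hb : b ≤ T + 1) (hp : ∀ t ∈ Finset.Icc 1 T, ∀ i, 0 ≤ p t i ∧ p t i ≤ 1)
    (hΔ : 0 < Δ) (hsub : HasMinSubopt p T Δ)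
    (hpq : ∀ r, a ≤ r → r < b → p r = p a) :
    ∑ r ∈ Finset.Ico a b, (best p r - p r (arm r)) ≤ 800 * (n / Δ * Real.log T) := by
  have hl : 0 ≤ Real.log T := Real.log_natCast_nonneg T
  rcases le_or_gt b a with hab | hab
  · rw [Finset.Ico_eq_empty_of_le hab, Finset.sum_empty]
    positivity
  have haT : a ∈ Finset.Icc 1 T := Finset.mem_Icc.2 ⟨ha, by omega⟩
  have hne : Nonempty (Fin n) := ⟨arm a⟩
  obtain ⟨w, hw⟩ := exists_eq_best p a
  have hs : ∑ r ∈ Finset.Ico a b, (best p r - p r (arm r)) =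
      ∑ r ∈ Finset.Ico a b, (best p a - p a (arm r)) := by
    refine Finset.sum_congr rfl fun r hr => ?_
    rw [Finset.mem_Ico] at hr
    have := hpq r hr.1 hr.2
    rw [best_congr this, this]
  rw [hs, sum_Ico_comp_arm arm click hab.le fun u => best p a - p a u]
  calc _ ≤ ∑ _u : Fin n, 800 * Real.log T / Δ := by
        refine Finset.sum_le_sum fun u _ => ?_
        have h1 := hr.plays_mul_gap_sq_le hc hT ha hab.le hb (hp a haT) hpq
          (u := u) (w := w) (hw ▸ le_best a u)
        rw [hw] at h1
        rw [le_div_iff₀ hΔ]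
        have hm : (0 : ℝ) ≤ plays (segment arm click a b) u := Nat.cast_nonneg _
        rcases (le_best a u : p a u ≤ best p a).lt_or_eq with h2 | h2
        · have h3 := hsub a haT u h2
          nlinarith [mul_nonneg hm (sub_nonneg.2 h2.le), mul_le_mul_of_nonneg_left h3
            (mul_nonneg hm (sub_nonneg.2 h2.le))]
        · rw [h2, sub_self, mul_zero, zero_mul]
          positivity
    _ = _ := by simp; ring

/-- The arm v* is played at least L/(2n) times, hence nearly optimal and accurately estimated. Any
other arm has a radius that is small either compared to its gap or compared to ε, since otherwise
every arm would be played too rarely to fill L rounds. -/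
lemma IsRun.accurateGuess {L : ℕ} (hr : IsRun (ucb T ε tie) arm click a (a + L))
    (hc : Concentrated p T arm click) (hT : 2 ≤ T) (ha : 1 ≤ a)
    (hb : a + L ≤ T + 1) (hp : ∀ t ∈ Finset.Icc 1 T, ∀ i, 0 ≤ p t i ∧ p t i ≤ 1)
    (hpq : ∀ r, a ≤ r → r < a + L → p r = p a) (hε : 0 < ε)
    (hL : 30000000 * (n / ε ^ 2 * Real.log T) ≤ L) :
    AccurateGuess p ε a ((ucb T ε tie).guess (segment arm click a (a + L))) := by
  have hl : 0 < Real.log T := by linarith [half_lt_log hT]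
  have hne : Nonempty (Fin n) := ⟨arm a⟩
  have hn : 0 < n := Fin.pos (arm a)
  have hn' : (0 : ℝ) < n := by exact_mod_cast hn
  have hL0 : (0 : ℝ) < L := lt_of_lt_of_le (by positivity) hL
  have hL1 : 1 ≤ L := by exact_mod_cast hL0
  have haT : a ∈ Finset.Icc 1 T := Finset.mem_Icc.2 ⟨ha, by omega⟩
  have hq := hp a haT
  have hL2 : 30000000 * (n * Real.log T) ≤ L * ε ^ 2 := by
    have : 30000000 * (n / ε ^ 2 * Real.log T) * ε ^ 2 = 30000000 * (n * Real.log T) := by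
      field_simp
    rw [← this]
    gcongr
  obtain ⟨w, hw⟩ := exists_eq_best p a
  have hwle : ∀ u, p a u ≤ p a w := fun u => hw ▸ le_best a u
  set h := segment arm click a (a + L) with hh
  set v := starArm tie h with hv
  have hmean : ∀ u, |mean h u - p a u| ≤ rad T (plays h u) :=
    abs_mean_sub_le hc hT ha (by omega) hb hq hpq
  -- the arm `v` was played often
  have hN : (L : ℝ) ≤ 2 * n * plays h v := by
    have hlen : h.length = L := by simp [hh]
    have hmem : v ∈ argmaxSet (plays (h.drop (h.length / 2))) :=
      tie.star_mem _ _ (argmaxSet_nonempty _)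
    simp only [argmaxSet, Finset.mem_filter, Finset.mem_univ, true_and] at hmem
    rw [hlen, hh, drop_segment] at hmem
    have h1 := sum_plays_segment arm click (a := a + L / 2) (b := a + L) (by omega)
    have h2 : ∑ u, (plays (segment arm click (a + L / 2) (a + L)) u : ℝ) ≤
        ∑ _u : Fin n, (plays h v : ℝ) := by
      refine Finset.sum_le_sum fun u _ => ?_
      exact_mod_cast (hmem u).trans (plays_segment_le_left arm click (by omega) (by omega) v)
    have h3 : (((L / 2 : ℕ) : ℝ)) ≤ L / 2 := Nat.cast_div_le
    rw [h1] at h2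
    simp only [Finset.sum_const, Finset.card_univ, Fintype.card_fin, nsmul_eq_mul] at h2
    push_cast at h2
    linarith
  -- The constant 30000000 is chosen for this step: it exceeds 2 · 800 · 128².
  have hgap : p a w - p a v ≤ ε / 128 := by
    have h1 := hr.plays_mul_gap_sq_le hc hT ha (by omega) hb hq hpq (hwle v)
    rw [← hh] at h1
    have h2 : (L : ℝ) * (p a w - p a v) ^ 2 ≤ 2 * n * plays h v * (p a w - p a v) ^ 2 := by
      gcongr
    have h3 : (L : ℝ) * (p a w - p a v) ^ 2 ≤ L * (ε / 128) ^ 2 := by nlinarith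
    exact le_of_sq_le_sq (le_of_mul_le_mul_left h3 hL0) (by positivity)
  have hrad : rad T (plays h v) ≤ ε / 128 := by
    have h1 := rad_sq T (plays h v)
    have h2 : (L : ℝ) * rad T (plays h v) ^ 2 ≤ 2 * n * plays h v * rad T (plays h v) ^ 2 := by
      gcongr
    have h3 : (L : ℝ) * rad T (plays h v) ^ 2 ≤ L * (ε / 128) ^ 2 := by
      nlinarith [mul_nonneg hn'.le (sq_nonneg (rad T (plays h v)))]
    exact le_of_sq_le_sq (le_of_mul_le_mul_left h3 hL0) (by positivity)
  have hstar := abs_le.1 (hmean v)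
  have hgap0 := hwle v
  -- the confidence radii of all other arms are small
  have hdich : ∀ u, 9 / 2 * rad T (plays h u) ≤ p a w - p a u ∨ rad T (plays h u) ≤ ε / 64 := by
    intro u
    by_contra! hcon
    have h1 := hr.length_mul_rad_sq_le hc hT ha (by omega) hb hq hpq hwle hcon.1
    rw [← hh] at h1
    push_cast at h1
    have h2 : (ε / 64) ^ 2 < rad T (plays h u) ^ 2 :=
      pow_lt_pow_left₀ hcon.2 (by positivity) (by norm_num)
    nlinarith [mul_lt_mul_of_pos_left h2 hL0, mul_pos hn' hl]
  have hest : ∀ u, gapEst tie h u = mean h v - mean h u := fun u => rfl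
  have hplus : ∀ u, u ∈ ((ucb T ε tie).guess h).1 ↔ gapEst tie h u ≤ ε / 4 := fun u => by
    simp [ucb]
  have hminus : ∀ u, u ∈ ((ucb T ε tie).guess h).2 ↔ ε / 2 < gapEst tie h u := fun u => by
    simp [ucb]
  -- The mean of v* is within ε/64 of the optimum and at most ε/128 above it; that of `u` is off by
  -- at most 2/9 of its gap or by ε/64. The tight cases are 7/9 · 3/8 - 1/64 > 1/4 and 11/9 · 3/8 +
  -- 1/128 < 1/2.
  refine ⟨fun u hu => ?_, fun u hu => ?_, fun u hu => ?_, fun u hu => ?_⟩ <;>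
    simp only [hplus, hminus, hest, ← hw] at hu ⊢ <;>
    have hm := abs_le.1 (hmean u) <;> have h0 := hwle u
  · rcases hdich u with h1 | h1 <;> linarith [hm.1, hstar.2]
  · by_contra! h2
    rcases hdich u with h1 | h1 <;> linarith [hm.2, hstar.1]
  · rcases hdich u with h1 | h1 <;> linarith [hm.2, hstar.1]
  · by_contra! h2
    rcases hdich u with h1 | h1 <;> linarith [hm.1, hstar.2]

end Best

/-! ### False positives of SafeCl and the diameter -/

section Samples

variable {X : Type*} {F : Set (X → Value)}

/-- Each sample was labeled `false` although `SafeCl` had classified it as positive. -/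
def SafeChain (F : Set (X → Value)) : List (X × Bool) → Prop
  | [] => True
  | c :: S => c.2 = false ∧ (safeCl F).positive S c.1 ∧ SafeChain F S

/-- The concept that made SafeCl classify a sample as positive is -1 on all older samples. The list
has the newest sample first, so the sequence is its reversal. -/
lemma SafeChain.exists_seq {S : List (X × Bool)} (h : SafeChain F S) :
    ∃ y : Fin S.length → X, (∀ t, ∃ f ∈ F, f (y t) = Value.pos ∧ ∀ s < t, f (y s) = Value.neg) ∧
      ∀ s, (y s, false) ∈ S := by
  induction S with
  | nil => exact ⟨Fin.elim0, fun t => t.elim0, fun t => t.elim0⟩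
  | cons c S ih =>
    obtain ⟨c, lab⟩ := c
    obtain ⟨hc, ⟨f, hf, hpos, hneg⟩, hS⟩ := h
    obtain ⟨y, hy, hmem⟩ := ih hS
    dsimp only at hc hpos
    subst hc
    refine ⟨Fin.snoc (α := fun _ => X) y c, fun t => ?_, fun s => ?_⟩
    · induction t using Fin.lastCases with
      | last =>
        refine ⟨f, hf, by simpa using hpos, fun s hs => ?_⟩
        induction s using Fin.lastCases with
        | last => exact absurd hs (lt_irrefl _)
        | cast s => simpa using hneg _ (hmem s)
      | cast t =>
        obtain ⟨g, hg, hgpos, hgneg⟩ := hy t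
        refine ⟨g, hg, by simpa using hgpos, fun s hs => ?_⟩
        induction s using Fin.lastCases with
        | last => exact absurd (hs.trans (Fin.castSucc_lt_last t)) (lt_irrefl _)
        | cast s => simpa using hgneg s (by simpa using hs)
    · induction s using Fin.lastCases with
      | last => simp
      | cast s => simpa using Or.inr (hmem s)

lemma SafeChain.length_le {S : List (X × Bool)} (h : SafeChain F S) {d : ℕ}
    (hd : diameter F = d) : S.length ≤ d := by
  obtain ⟨y, hy, -⟩ := h.exists_seq
  have : ((S.length : ℕ) : ℕ∞) ≤ diameter F := le_sSup ⟨S.length, rfl, y, hy⟩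
  rw [hd] at this
  exact_mod_cast this

end Samples

/-! ### Events and quiet stretches -/

section Events

variable {n : ℕ} {p : ℕ → Fin n → ℝ} {T : ℕ}

/-- There is no event strictly between the rounds `a` and `b`. -/
def Quiet (p : ℕ → Fin n → ℝ) (T a b : ℕ) : Prop := ∀ e ∈ events p T, a < e → b ≤ e

lemma mem_events {t : ℕ} : t ∈ events p T ↔ (2 ≤ t ∧ t ≤ T) ∧ p (t - 1) ≠ p t := by
  simp [events]

lemma Quiet.eq {a b : ℕ} (h : Quiet p T a b) (ha : 1 ≤ a) (hb : b ≤ T + 1) {r : ℕ} (har : a ≤ r)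
    (hrb : r < b) : p r = p a := by
  induction r, har using Nat.le_induction with
  | base => rfl
  | succ r har ih =>
    rw [← ih (by omega)]
    by_contra hne
    have := h (r + 1) (mem_events.2 ⟨by omega, fun h' => hne (by simpa using h'.symm)⟩) (by omega)
    omega

/-- The number of events before round `t`. -/
noncomputable def eventsBefore (p : ℕ → Fin n → ℝ) (T t : ℕ) : ℕ :=
  ((events p T).filter (· < t)).card

lemma eventsBefore_mono {s t : ℕ} (h : s ≤ t) : eventsBefore p T s ≤ eventsBefore p T t := by
  refine Finset.card_le_card fun e he => ?_
  simp only [Finset.mem_filter] at he ⊢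
  exact ⟨he.1, he.2.trans_le h⟩

lemma eventsBefore_lt {s t e : ℕ} (he : e ∈ events p T) (hs : s ≤ e) (ht : e < t) :
    eventsBefore p T s + 1 ≤ eventsBefore p T t := by
  refine Finset.card_lt_card (Finset.ssubset_iff_of_subset (fun e he => ?_) |>.2 ⟨e, ?_, ?_⟩)
  · simp only [Finset.mem_filter] at he ⊢
    exact ⟨he.1, by omega⟩
  · simp [he, ht]
  · simp [hs]

lemma eventsBefore_le (t : ℕ) : eventsBefore p T t ≤ (events p T).card :=
  Finset.card_filter_le _ _

end Events

/-- The hypotheses on an instance of the problem, with event oracle `f₀`. -/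
structure Admissible {X : Type*} {n : ℕ} (T L : ℕ) (ε Δ : ℝ) (p : ℕ → Fin n → ℝ) (x : ℕ → X)
    (f₀ : X → Value) : Prop where
  two_le : 2 ≤ T
  prob_mem : ∀ t ∈ Finset.Icc 1 T, ∀ i, 0 ≤ p t i ∧ p t i ≤ 1
  oracle : IsEventOracle p x T f₀
  eps_pos : 0 < ε
  shift : HasMinShift p T ε
  gap_pos : 0 < Δ
  subopt : HasMinSubopt p T Δ
  length_pos : 1 ≤ L
  le_length : 30000000 * (n / ε ^ 2 * Real.log T) ≤ L
  apart : EventsApart p T (2 * L)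

/-- The regret of a run in the absence of events. -/
noncomputable def phaseRegret (n T : ℕ) (Δ : ℝ) : ℝ := 800 * (n / Δ * Real.log T)

lemma best_sub_le_one {n T : ℕ} {p : ℕ → Fin n → ℝ}
    (hp : ∀ t ∈ Finset.Icc 1 T, ∀ i, 0 ≤ p t i ∧ p t i ≤ 1) {t : ℕ} (h1 : 1 ≤ t) (h2 : t ≤ T)
    (i : Fin n) : best p t - p t i ≤ 1 := by
  have hne : Nonempty (Fin n) := ⟨i⟩
  obtain ⟨w, hw⟩ := exists_eq_best p t
  have ht := Finset.mem_Icc.2 ⟨h1, h2⟩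
  rw [← hw]
  linarith [(hp t ht w).2, (hp t ht i).1]

/-! ### Regret of a single phase -/

section Phase

variable {X : Type*} {n T L : ℕ} {ε Δ : ℝ} {p : ℕ → Fin n → ℝ} {x : ℕ → X} {f₀ : X → Value}
  {arm : ℕ → Fin n} {click : ℕ → Bool} {a b : ℕ} {tie : TieBreak n}

lemma Admissible.phaseRegret_nonneg (H : Admissible T L ε Δ p x f₀) : 0 ≤ phaseRegret n T Δ := by
  have := H.gap_pos
  have hl : 0 ≤ Real.log T := Real.log_natCast_nonneg T
  unfold phaseRegret; positivity

lemma Admissible.quiet_of_mem (H : Admissible T L ε Δ p x f₀) (ha : a ∈ events p T)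
    (hb : b ≤ a + 2 * L) : Quiet p T a b :=
  fun e he hae => hb.trans (H.apart a ha e he hae)

lemma Admissible.sum_gap_le_of_quiet (H : Admissible T L ε Δ p x f₀)
    (hc : Concentrated p T arm click) (hr : IsRun (ucb T ε tie) arm click a b)
    (ha : 1 ≤ a) (hb : b ≤ T + 1) (hq : Quiet p T a b) :
    ∑ r ∈ Finset.Ico a b, (best p r - p r (arm r)) ≤ phaseRegret n T Δ :=
  hr.sum_gap_le hc H.two_le ha hb H.prob_mem H.gap_pos H.subopt
    fun _ h1 h2 => hq.eq ha hb h1 h2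

lemma Admissible.accurateGuess (H : Admissible T L ε Δ p x f₀)
    (hc : Concentrated p T arm click) (hr : IsRun (ucb T ε tie) arm click a (a + L))
    (ha : 1 ≤ a) (hb : a + L ≤ T + 1) (hq : Quiet p T a (a + L)) :
    AccurateGuess p ε a ((ucb T ε tie).guess (segment arm click a (a + L))) :=
  hr.accurateGuess hc H.two_le ha hb H.prob_mem (fun _ h1 h2 => hq.eq ha hb h1 h2) H.eps_pos
    H.le_length

/-- A run of at most `L` rounds contains at most one event after its first round. -/
lemma Admissible.sum_gap_le (H : Admissible T L ε Δ p x f₀)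
    (hc : Concentrated p T arm click) (hr : IsRun (ucb T ε tie) arm click a b)
    (ha : 1 ≤ a) (hab : a ≤ b) (hb : b ≤ T + 1) (hL : b ≤ a + L) :
    ∑ r ∈ Finset.Ico a b, (best p r - p r (arm r)) + L * eventsBefore p T a ≤
      phaseRegret n T Δ + L * eventsBefore p T b := by
  by_cases hq : Quiet p T a b
  · have h1 := H.sum_gap_le_of_quiet hc hr ha hb hq
    have h2 : (eventsBefore p T a : ℝ) ≤ eventsBefore p T b := by
      exact_mod_cast eventsBefore_mono hab
    gcongr
  · simp only [Quiet] at hq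
    push Not at hq
    obtain ⟨e, he, hae, heb⟩ := hq
    -- Two events inside the run would be less than L rounds apart. Up to the event `e` the run is
    -- quiet, and from then on each of at most L rounds costs at most 1.
    have hq1 : Quiet p T a e := fun e' he' hae' => by
      by_contra! hlt
      have := H.apart e' he' e he hlt
      omega
    have h1 := H.sum_gap_le_of_quiet hc (hr.mono heb.le) ha (by omega) hq1
    have h2 : (eventsBefore p T a : ℝ) + 1 ≤ eventsBefore p T b := by
      exact_mod_cast eventsBefore_lt he hae.le heb
    have h3 : ∑ r ∈ Finset.Ico e b, (best p r - p r (arm r)) ≤ L := by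
      calc _ ≤ ∑ _r ∈ Finset.Ico e b, (1 : ℝ) := by
            refine Finset.sum_le_sum fun r hr => ?_
            rw [Finset.mem_Ico] at hr
            exact best_sub_le_one H.prob_mem (by omega) (by omega) _
        _ = ((b - e : ℕ) : ℝ) := by simp
        _ ≤ L := by exact_mod_cast (by omega)
    rw [← Finset.sum_Ico_consecutive _ hae.le heb.le]
    nlinarith [(Nat.cast_nonneg L : (0 : ℝ) ≤ L)]

end Phase

/-! ### The invariant of BWC -/

section Invariant

variable {X : Type*} {n : ℕ}

/-- `lastPlus` stems from the full phase that started in round `a`, the next phase starts in round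
`c`, and the guess is accurate unless there was an event in the meantime. -/
structure LastFull (p : ℕ → Fin n → ℝ) (T L : ℕ) (ε : ℝ) (a c : ℕ)
    (lastPlus : Option (Finset (Fin n))) : Prop where
  pos : 1 ≤ a
  le : a + L ≤ c
  no_event : ∀ e ∈ events p T, a + L ≤ e → c ≤ e
  recent : (∀ e ∈ events p T, a ≤ e → c ≤ e) ∨ c < a + 2 * L
  accurate : ∃ G, lastPlus = some G.1 ∧ (Quiet p T a (a + L) → AccurateGuess p ε a G)

/-- The invariant of `BWC` before round `t`, provided that the clicks are concentrated. -/
structure Invariant (F : Set (X → Value)) (T L : ℕ) (ε Δ : ℝ) (p : ℕ → Fin n → ℝ) (x : ℕ → X)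
    (f₀ : X → Value) (tie : ℕ → TieBreak n) (arm : ℕ → Fin n) (click : ℕ → Bool)
    (t : ℕ) (s : State X n) : Prop where
  start_pos : 1 ≤ s.start
  start_le : s.start ≤ t
  hist_eq : s.hist = segment arm click s.start t
  isRun : IsRun (ucb T ε (tie s.start)) arm click s.start t
  chain : SafeChain F s.samples
  neg : ∀ y, (y, false) ∈ s.samples → f₀ y = Value.neg
  lt_of_testing : s.testing = true → t < s.start + L
  positive : s.testing = true → s.start ≠ 1 → (safeCl F).positive s.samples (x s.start)
  adapting : s.testing = false → 2 ≤ s.start ∧ ∀ e ∈ events p T, s.start ≤ e → t ≤ e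
  phase : ∃ M : ℕ,
    ∑ r ∈ Finset.Ico 1 s.start, (best p r - p r (arm r)) +
        (if s.testing then 0 else phaseRegret n T Δ) ≤
      2 * M * phaseRegret n T Δ + L * eventsBefore p T s.start ∧
    M ≤ 1 + s.samples.length + 2 * eventsBefore p T s.start ∧
    ((s.testing = true ∧ s.start = 1 ∧ s.lastPlus = none ∧ M = 0) ∨
      ∃ a, LastFull p T L ε a s.start s.lastPlus ∧ (s.testing = false → s.start = a + L) ∧
        (¬ Quiet p T a (a + L) → M ≤ s.samples.length + 2 * eventsBefore p T s.start))

variable {F : Set (X → Value)} {T L : ℕ} {ε Δ : ℝ} {p : ℕ → Fin n → ℝ} {x : ℕ → X}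
  {f₀ : X → Value} {tie : ℕ → TieBreak n} {arm : ℕ → Fin n} {click : ℕ → Bool}

lemma invariant_init (H : Admissible T L ε Δ p x f₀) :
    Invariant F T L ε Δ p x f₀ tie arm click 1 (State.init X n) where
  start_pos := le_rfl
  start_le := le_rfl
  hist_eq := by simp [State.init]
  isRun := fun r h1 h2 => absurd (h2.trans_le h1) (lt_irrefl _)
  chain := trivial
  neg := by simp [State.init]
  lt_of_testing := fun _ => by have := H.length_pos; simp only [State.init]; omega
  positive := fun _ h => absurd rfl h
  adapting := by simp [State.init]
  phase := ⟨0, by simp [State.init]; positivity, by simp, Or.inl ⟨rfl, rfl, rfl, rfl⟩⟩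

/-- An adapting phase contains no event, so it costs at most one `phaseRegret`, which the invariant
has already charged at its start. -/
lemma Invariant.startRound (H : Admissible T L ε Δ p x f₀) (hc : Concentrated p T arm click)
    (hf : f₀ ∈ F) {t : ℕ} (htT : t ≤ T) {s : State X n}
    (hI : Invariant F T L ε Δ p x f₀ tie arm click t s) :
    let σ := s.startRound L (fun a => ucb T ε (tie a)) (safeCl F) x t
    Invariant F T L ε Δ p x f₀ tie arm click t σ ∧ (σ.testing = false → t ∉ events p T) := by
  intro σ
  by_cases hsw : s.testing = false ∧ (safeCl F).positive s.samples (x t)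
  · obtain ⟨hs, hpos⟩ := hsw
    have hσ : σ = { testing := true
                    start := t
                    hist := []
                    lastPlus := if L ≤ s.hist.length then
                      some ((ucb T ε (tie s.start)).guess (s.hist.take L)).1 else s.lastPlus
                    samples := s.samples } := if_pos ⟨hs, hpos⟩
    have hL := H.length_pos
    obtain ⟨h2, hno⟩ := hI.adapting hs
    obtain ⟨M, hreg, hM, hlast⟩ := hI.phase
    have hst := hI.start_le
    have hq : Quiet p T s.start t := fun e he hlt => hno e he hlt.le
    have hev := eventsBefore_mono (p := p) (T := T) hst
    rw [hσ]
    refine ⟨⟨by dsimp only; omega, le_rfl, by simp,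
      fun r h1 h2 => absurd (h2.trans_le h1) (lt_irrefl _), hI.chain, hI.neg,
      fun _ => by dsimp only; omega, fun _ _ => hpos, by simp, M, ?_, by dsimp only; omega,
      Or.inr ?_⟩, by simp⟩
    · have h3 := H.sum_gap_le_of_quiet hc hI.isRun hI.start_pos (by omega) hq
      have h4 : (eventsBefore p T s.start : ℝ) ≤ eventsBefore p T t := by exact_mod_cast hev
      have h5 := mul_le_mul_of_nonneg_left h4 (Nat.cast_nonneg L : (0 : ℝ) ≤ L)
      rw [hs] at hreg
      simp only [Bool.false_eq_true, if_false] at hreg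
      simp only [if_true, add_zero]
      rw [← Finset.sum_Ico_consecutive _ hI.start_pos hst]
      linarith
    · rcases hlast with hlast | ⟨a, hlast, ha, hMa⟩
      · rw [hs] at hlast
        exact absurd hlast.1 (by simp)
      have hlen : s.hist.length = t - s.start := by rw [hI.hist_eq, length_segment]
      dsimp only
      by_cases hfull : L ≤ s.hist.length
      · rw [if_pos hfull]
        have htake : s.hist.take L = segment arm click s.start (s.start + L) := by
          rw [hI.hist_eq, take_segment _ _ (by omega)]
        refine ⟨s.start, ⟨hI.start_pos, by omega, fun e he h => hno e he (by omega),
          Or.inl hno, _, rfl, fun hq' => ?_⟩, by simp, fun hnq => ?_⟩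
        · rw [htake]
          exact H.accurateGuess hc (hI.isRun.mono (by omega)) hI.start_pos (by omega) hq'
        · exact absurd (fun e he hlt => le_trans (by omega) (hq e he hlt)) hnq
      -- The adapting phase was short, so the last full phase is still the testing phase just before
      -- it, and `t` lies less than 2L rounds after its start.
      · rw [if_neg hfull]
        have hsa := ha hs
        refine ⟨a, ⟨hlast.pos, by omega, fun e he h => hno e he (by omega), Or.inr (by omega),
          hlast.accurate⟩, by simp, fun hnq => ?_⟩
        have := hMa hnq
        omega
  · have hσ : σ = s := if_neg hsw
    rw [hσ]
    -- At an event the oracle itself is a concept that is +1 here and -1 on all samples, which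
    -- forces a positive prediction.
    refine ⟨hI, fun hs ht => hsw ⟨hs, f₀, hf, ?_, hI.neg⟩⟩
    exact (H.oracle t (Finset.mem_of_mem_filter t ht)).1 ht

/-- In the invariant, `M` counts the completed testing phases. An event after the first round of a
testing phase pays for two of them, this one and the next; the sharper bound on `M` when the last
full phase is not quiet stores the unused unit for the next testing phase. -/
lemma Invariant.endRound (H : Admissible T L ε Δ p x f₀) (hc : Concentrated p T arm click)
    {t : ℕ} (htT : t ≤ T) {s : State X n}
    (hI : Invariant F T L ε Δ p x f₀ tie arm click t s) (hev : s.testing = false → t ∉ events p T)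
    (harm : arm t = s.arm fun a => ucb T ε (tie a)) :
    Invariant F T L ε Δ p x f₀ tie arm click (t + 1)
      (s.endRound L (fun a => ucb T ε (tie a)) x t (click t)) := by
  have hL := H.length_pos
  have hst := hI.start_le
  have hs1 := hI.start_pos
  have hh : s.hist ++ [(s.arm (fun a => ucb T ε (tie a)), click t)] =
      segment arm click s.start (t + 1) := by
    rw [segment_succ _ _ hst, ← harm, hI.hist_eq]
  have hrun : IsRun (ucb T ε (tie s.start)) arm click s.start (t + 1) := by
    intro r h1 h2
    rcases Nat.lt_succ_iff_lt_or_eq.1 h2 with h3 | rfl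
    · exact hI.isRun r h1 h3
    · rw [harm, State.arm, hI.hist_eq]
  have hlen : (segment arm click s.start (t + 1)).length = t + 1 - s.start := length_segment ..
  unfold State.endRound
  simp only [hh]
  split_ifs with hend hlab
  rotate_left 2
  · -- the phase goes on
    refine ⟨hs1, by dsimp only; omega, rfl, hrun, hI.chain, hI.neg, fun hs => ?_, hI.positive,
      fun hs => ⟨(hI.adapting hs).1, fun e he hse => ?_⟩, hI.phase⟩
    · have h1 := hI.lt_of_testing hs
      have h2 : ¬ (segment arm click s.start (t + 1)).length = L := fun h => hend ⟨hs, h⟩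
      dsimp only
      omega
    · have h1 := (hI.adapting hs).2 e he hse
      have h2 : t ≠ e := fun h => hev hs (h ▸ he)
      omega
  all_goals
    obtain ⟨hs, hlenL⟩ := hend
    have htL : t + 1 = s.start + L := by omega
    obtain ⟨M, hreg, hM, hlast⟩ := hI.phase
    rw [htL] at hrun ⊢
    have hmono := eventsBefore_mono (p := p) (T := T) (show s.start ≤ s.start + L by omega)
    have hsum := H.sum_gap_le hc hrun hs1 (by omega) (by omega) le_rfl
    have hreg' : ∑ r ∈ Finset.Ico 1 (s.start + L), (best p r - p r (arm r)) + phaseRegret n T Δ ≤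
        2 * ((M + 1 : ℕ) : ℝ) * phaseRegret n T Δ + L * eventsBefore p T (s.start + L) := by
      rw [hs] at hreg
      simp only [if_true, add_zero] at hreg
      rw [← Finset.sum_Ico_consecutive _ hs1 (show s.start ≤ s.start + L by omega)]
      push_cast
      linarith
    have hinc : ∀ e ∈ events p T, s.start ≤ e → e < s.start + L →
        eventsBefore p T s.start + 1 ≤ eventsBefore p T (s.start + L) :=
      fun e he h1 h2 => eventsBefore_lt he h1 h2
    have hnq : ¬ Quiet p T s.start (s.start + L) →
        eventsBefore p T s.start + 1 ≤ eventsBefore p T (s.start + L) := by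
      intro h
      simp only [Quiet] at h
      push Not at h
      obtain ⟨e, he, h1, h2⟩ := h
      exact hinc e he h1.le h2
    have hacc := H.accurateGuess hc hrun hs1 (by omega)
    have hfull : LastFull p T L ε s.start (s.start + L)
        (some ((ucb T ε (tie s.start)).guess (segment arm click s.start (s.start + L))).1) :=
      ⟨hs1, le_rfl, fun _ _ h => h, Or.inr (by omega), _, rfl, hacc⟩
  · -- the context of the first round of the phase is labeled `false`
    obtain ⟨G', hG', hdisj⟩ := hlab
    rw [htL] at hdisj
    rcases hlast with ⟨-, -, hnone, -⟩ | ⟨a, hlast, -, hMa⟩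
    · simp [hnone] at hG'
    obtain ⟨G, hG, haccG⟩ := hlast.accurate
    obtain rfl : G.1 = G' := by simpa [hG] using hG'
    have ha1 := hlast.pos
    have hac := hlast.le
    -- At an event, the minimum shift would supply an arm in both sets. This needs the stretch from
    -- the last full phase up to here to be quiet, which `recent` and the spacing of the events
    -- ensure.
    have hnev : s.start ∉ events p T := by
      intro hse
      have hqa : Quiet p T a s.start := by
        intro e he hae
        by_contra! hlt
        rcases hlast.recent with h | h
        · have := h e he hae.le
          omega
        · have := H.apart e he _ hse hlt
          omega
      obtain ⟨i, hi1, hi2⟩ := H.shift _ hse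
      have hpa : p (s.start - 1) = p a := hqa.eq ha1 (by omega) (by omega) (by omega)
      rw [best_congr hpa, hpa] at hi1
      have hi : i ∈ G.1 ∩ ((ucb T ε (tie s.start)).guess
          (segment arm click s.start (s.start + L))).2 := by
        refine Finset.mem_inter.2 ⟨(haccG fun e he h => hac.trans (hqa e he h)).mem_plus i hi1, ?_⟩
        exact (hacc (H.quiet_of_mem hse (by omega))).mem_minus i (by linarith)
      rw [hdisj] at hi
      simp at hi
    refine ⟨by dsimp only; omega, le_rfl, by simp,
      fun r h1 h2 => absurd (h2.trans_le h1) (lt_irrefl _),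
      ⟨rfl, hI.positive hs (by omega), hI.chain⟩, fun y hy => ?_, by simp, by simp,
      fun _ => ⟨by dsimp only; omega, fun _ _ h => h⟩, M + 1, by simpa using hreg', ?_,
      Or.inr ⟨s.start, hfull, fun _ => rfl, fun h => ?_⟩⟩
    · simp only [List.mem_cons, Prod.mk.injEq, and_true] at hy
      rcases hy with rfl | hy
      · exact (H.oracle _ (Finset.mem_Icc.2 ⟨by omega, by omega⟩)).2 hnev
      · exact hI.neg y hy
    · simp only [List.length_cons]
      omega
    · have := hnq h
      simp only [List.length_cons]
      omega
  · -- no sample is added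
    rw [htL] at hlab
    -- If the phase is not the first, and there is no event in it or in the full phase before, then
    -- both guesses refer to the same probabilities and are separated by the gap 3ε/8. A sample
    -- would have been added.
    have hcount : (M = 0 ∨ M ≤ s.samples.length + 2 * eventsBefore p T s.start) ∨
        eventsBefore p T s.start + 1 ≤ eventsBefore p T (s.start + L) := by
      rcases hlast with ⟨-, -, -, h0⟩ | ⟨a, hlast, -, hMa⟩
      · exact Or.inl (Or.inl h0)
      by_contra! hcon
      have hqs : Quiet p T s.start (s.start + L) := by
        by_contra h
        have := hnq h
        omega
      have hqa : Quiet p T a (a + L) := by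
        by_contra h
        have := hMa h
        omega
      have hsn : s.start ∉ events p T := fun h => by
        have := hinc _ h le_rfl (by omega)
        omega
      obtain ⟨G, hG, haccG⟩ := hlast.accurate
      have hac := hlast.le
      have hq : Quiet p T a (s.start + L) := fun e he hae => by
        have h1 := hlast.no_event e he (hqa e he hae)
        exact hqs e he (lt_of_le_of_ne h1 fun h => hsn (h ▸ he))
      have hps : p s.start = p a := hq.eq hlast.pos (by omega) (by omega) (by omega)
      refine hlab ⟨G.1, hG, Finset.eq_empty_of_forall_notMem fun v hv => ?_⟩
      rw [Finset.mem_inter] at hv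
      have h1 := (haccG hqa).gap_le v hv.1
      have h2 := (hacc hqs).lt_gap v hv.2
      rw [best_congr hps, hps] at h2
      linarith
    refine ⟨by dsimp only; omega, le_rfl, by simp,
      fun r h1 h2 => absurd (h2.trans_le h1) (lt_irrefl _),
      hI.chain, hI.neg, by simp, by simp,
      fun _ => ⟨by dsimp only; omega, fun _ _ h => h⟩, M + 1, by simpa using hreg', ?_,
      Or.inr ⟨s.start, hfull, fun _ => rfl, fun h => ?_⟩⟩
    · dsimp only
      omega
    · have := hnq h
      dsimp only
      omega

/-- The regret of `BWC` if the clicks are concentrated. -/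
lemma sum_gap_le_of_concentrated (H : Admissible T L ε Δ p x f₀) (hf : f₀ ∈ F) {d : ℕ}
    (hd : diameter F = d) (ω : Finset ℕ)
    (hc : Concentrated p T (armAt L (fun a => ucb T ε (tie a)) (safeCl F) x ω)
      fun t => decide (t ∈ ω)) :
    ∑ t ∈ Finset.Icc 1 T,
        (best p t - p t (armAt L (fun a => ucb T ε (tie a)) (safeCl F) x ω t)) ≤
      (2 * d + 4 * (events p T).card + 3) * phaseRegret n T Δ + L * (events p T).card := by
  set arm := armAt L (fun a => ucb T ε (tie a)) (safeCl F) x ω with harm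
  set click : ℕ → Bool := fun t => decide (t ∈ ω) with hclick
  have hI : ∀ t ≤ T, Invariant F T L ε Δ p x f₀ tie arm click (t + 1)
      (run L (fun a => ucb T ε (tie a)) (safeCl F) x ω t) := by
    intro t
    induction t with
    | zero => exact fun _ => invariant_init H
    | succ t ih =>
      intro ht
      obtain ⟨h1, h2⟩ := (ih (by omega)).startRound H hc hf ht
      exact h1.endRound H hc ht h2 rfl
  have hT := hI T le_rfl
  generalize run L (fun a => ucb T ε (tie a)) (safeCl F) x ω T = s at hT
  obtain ⟨M, hreg, hM, -⟩ := hT.phase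
  have hA := H.phaseRegret_nonneg
  have hlen := hT.chain.length_le hd
  have hev := eventsBefore_le (p := p) (T := T) (T + 1)
  have hev' := eventsBefore_mono (p := p) (T := T) hT.start_le
  have hM' : (M : ℝ) ≤ 1 + d + 2 * (events p T).card := by exact_mod_cast (by omega)
  -- The last phase may be cut off by the horizon; it accounts for the odd `phaseRegret` in 3 = 2 ·
  -- 1 + 1.
  have h1 : ∑ r ∈ Finset.Ico s.start (T + 1), (best p r - p r (arm r)) +
      L * eventsBefore p T s.start ≤ phaseRegret n T Δ + L * eventsBefore p T (T + 1) := by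
    by_cases hs : s.testing = true
    · exact H.sum_gap_le hc hT.isRun hT.start_pos hT.start_le le_rfl (hT.lt_of_testing hs).le
    · have h2 := H.sum_gap_le_of_quiet hc hT.isRun hT.start_pos le_rfl
        fun e he hlt => (hT.adapting (by simpa using hs)).2 e he hlt.le
      have h3 : (eventsBefore p T s.start : ℝ) ≤ eventsBefore p T (T + 1) := by
        exact_mod_cast hev'
      gcongr
  have h2 : (0 : ℝ) ≤ if s.testing then 0 else phaseRegret n T Δ := by split_ifs <;> simp [hA]
  have h3 : (L : ℝ) * eventsBefore p T (T + 1) ≤ L * (events p T).card := by gcongr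
  have h4 : (M : ℝ) * phaseRegret n T Δ ≤ (1 + d + 2 * (events p T).card) * phaseRegret n T Δ := by
    gcongr
  rw [show Finset.Icc 1 T = Finset.Ico 1 (T + 1) by ext; simp,
    ← Finset.sum_Ico_consecutive _ hT.start_pos hT.start_le]
  linarith

end Invariant

/-! ### Exponential moments of adaptively chosen clicks -/

/-- A product of conditional weights has total mass at most one. -/
lemma sum_powerset_prod_le_one (T : ℕ) (w : ℕ → Finset ℕ → ℝ)
    (h0 : ∀ t ∈ Finset.Icc 1 T, ∀ ω, 0 ≤ w t ω)
    (hdep : ∀ t ω r, t < r → w t (insert r ω) = w t ω)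
    (h1 : ∀ t ∈ Finset.Icc 1 T, ∀ ω, t ∉ ω → w t ω + w t (insert t ω) ≤ 1) :
    ∑ ω ∈ (Finset.Icc 1 T).powerset, ∏ t ∈ Finset.Icc 1 T, w t ω ≤ 1 := by
  induction T with
  | zero => simp
  | succ T ih =>
    have hsub : Finset.Icc 1 T ⊆ Finset.Icc 1 (T + 1) := Finset.Icc_subset_Icc_right T.le_succ
    have hmem : T + 1 ∈ Finset.Icc 1 (T + 1) := by simp
    have hins : Finset.Icc 1 (T + 1) = insert (T + 1) (Finset.Icc 1 T) :=
      (Finset.insert_Icc_right_eq_Icc_add_one (by omega)).symm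
    have hnot : T + 1 ∉ Finset.Icc 1 T := by simp
    have ih' := ih (fun t ht => h0 t (hsub ht)) fun t ht => h1 t (hsub ht)
    refine le_trans ?_ ih'
    -- Summing out the last round first leaves all earlier factors unchanged, as they do not depend
    -- on it.
    rw [hins, Finset.sum_powerset_insert hnot, ← Finset.sum_add_distrib]
    refine Finset.sum_le_sum fun ω hω => ?_
    rw [Finset.prod_insert hnot, Finset.prod_insert hnot]
    have hprod : ∏ t ∈ Finset.Icc 1 T, w t (insert (T + 1) ω) = ∏ t ∈ Finset.Icc 1 T, w t ω := by
      refine Finset.prod_congr rfl fun t ht => hdep t ω _ ?_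
      rw [Finset.mem_Icc] at ht
      omega
    have hω' : T + 1 ∉ ω := fun h => hnot (Finset.mem_powerset.1 hω h)
    rw [hprod, ← add_mul]
    exact mul_le_of_le_one_left (Finset.prod_nonneg fun t ht => h0 t (hsub ht) ω)
      (h1 _ hmem ω hω')

/-- Hoeffding's lemma for a Bernoulli variable. -/
lemma bernoulli_exp_le {q : ℝ} (h0 : 0 ≤ q) (h1 : q ≤ 1) (l : ℝ) :
    (1 - q) * Real.exp (-(l * q)) + q * Real.exp (l * (1 - q)) ≤ Real.exp (l ^ 2 / 8) := by
  let μ : MeasureTheory.Measure ℝ := ENNReal.ofReal (1 - q) • MeasureTheory.Measure.dirac 0 +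
    ENNReal.ofReal q • MeasureTheory.Measure.dirac 1
  have hint : ∀ f : ℝ → ℝ, ∫ y, f y ∂μ = (1 - q) * f 0 + q * f 1 := by
    intro f
    rw [MeasureTheory.integral_add_measure]
    · simp [MeasureTheory.integral_smul_measure, h0, h1]
    · exact (MeasureTheory.integrable_dirac (by simp)).smul_measure (by simp)
    · exact (MeasureTheory.integrable_dirac (by simp)).smul_measure (by simp)
  have hμ : MeasureTheory.IsProbabilityMeasure μ := ⟨by
    simp only [μ, MeasureTheory.Measure.coe_add, MeasureTheory.Measure.coe_smul, Pi.add_apply,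
      Pi.smul_apply, MeasureTheory.measure_univ, smul_eq_mul, mul_one]
    rw [← ENNReal.ofReal_add (by linarith) h0]
    simp⟩
  have hae : ∀ᵐ y ∂μ, (id y : ℝ) ∈ Set.Icc (0 : ℝ) 1 := by
    simp only [μ, MeasureTheory.ae_add_measure_iff]
    constructor <;>
    · refine MeasureTheory.Measure.ae_smul_measure ?_ _
      simp [MeasureTheory.ae_dirac_eq]
  have h := (ProbabilityTheory.hasSubgaussianMGF_of_mem_Icc (X := id) (a := 0) (b := 1)
    measurable_id.aemeasurable hae).mgf_le l
  rw [ProbabilityTheory.mgf, hint, hint] at h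
  simp only [id, mul_zero, mul_one, zero_add] at h
  convert h using 2
  · simp
  · norm_num
    ring

/-! ### Concentration of the clicks and expected regret -/

section Run

variable {X : Type*} {n : ℕ} (L : ℕ) (B : ℕ → Bandit n) (K : Classifier X) (x : ℕ → X)

lemma run_insert {t r : ℕ} (h : t < r) (ω : Finset ℕ) :
    run L B K x (insert r ω) t = run L B K x ω t := by
  induction t with
  | zero => rfl
  | succ t ih =>
    rw [run, run, ih (by omega)]
    have : (t + 1 ∈ insert r ω) ↔ t + 1 ∈ ω := by simp [h.ne]
    simp only [this]

lemma armAt_insert {t r : ℕ} (h : t ≤ r) (hr : 1 ≤ r) (ω : Finset ℕ) :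
    armAt L B K x (insert r ω) t = armAt L B K x ω t := by
  unfold armAt
  rw [run_insert L B K x (by omega)]

variable {p : ℕ → Fin n → ℝ} {T : ℕ}

/-- The excess of the clicks on arm `u` in the rounds `a ≤ r < b` over their expectation. -/
noncomputable def deviation (p : ℕ → Fin n → ℝ) (a b : ℕ) (u : Fin n) (ω : Finset ℕ) : ℝ :=
  ∑ r ∈ Finset.Ico a b,
    if armAt L B K x ω r = u then (if r ∈ ω then 1 else 0) - p r u else 0

/-- The number of plays of arm `u` in the rounds `a ≤ r < b`. -/
noncomputable def playCount (a b : ℕ) (u : Fin n) (ω : Finset ℕ) : ℕ :=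
  ∑ r ∈ Finset.Ico a b, if armAt L B K x ω r = u then 1 else 0

lemma prob_nonneg (hp : ∀ t ∈ Finset.Icc 1 T, ∀ i, 0 ≤ p t i ∧ p t i ≤ 1) (ω : Finset ℕ) :
    0 ≤ prob L B K x p T ω := by
  refine Finset.prod_nonneg fun t ht => ?_
  have := hp t ht (armAt L B K x ω t)
  split_ifs <;> linarith

/-- The exponential supermartingale of the deviations. -/
lemma sum_prob_mul_exp_le_one (hp : ∀ t ∈ Finset.Icc 1 T, ∀ i, 0 ≤ p t i ∧ p t i ≤ 1)
    {a b : ℕ} (ha : 1 ≤ a) (hb : b ≤ T + 1) (u : Fin n) (l : ℝ) :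
    ∑ ω ∈ (Finset.Icc 1 T).powerset, prob L B K x p T ω *
      Real.exp (l * deviation L B K x p a b u ω - l ^ 2 / 8 * playCount L B K x a b u ω) ≤ 1 := by
  let w : ℕ → Finset ℕ → ℝ := fun t ω =>
    (if t ∈ ω then p t (armAt L B K x ω t) else 1 - p t (armAt L B K x ω t)) *
      Real.exp (if t ∈ Finset.Ico a b ∧ armAt L B K x ω t = u then
        l * ((if t ∈ ω then 1 else 0) - p t u) - l ^ 2 / 8 else 0)
  have hsub : Finset.Ico a b ⊆ Finset.Icc 1 T := fun t ht => by
    rw [Finset.mem_Ico] at ht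
    exact Finset.mem_Icc.2 ⟨by omega, by omega⟩
  have hw : ∀ ω, prob L B K x p T ω *
      Real.exp (l * deviation L B K x p a b u ω - l ^ 2 / 8 * playCount L B K x a b u ω) =
      ∏ t ∈ Finset.Icc 1 T, w t ω := by
    intro ω
    rw [Finset.prod_mul_distrib, ← Real.exp_sum]
    unfold prob deviation playCount
    congr 2
    push_cast
    rw [Finset.mul_sum, Finset.mul_sum, ← Finset.sum_sub_distrib]
    simp_rw [ite_and]
    rw [← Finset.sum_filter, Finset.filter_mem_eq_inter, Finset.inter_eq_right.2 hsub]
    refine Finset.sum_congr rfl fun r _ => ?_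
    split_ifs <;> ring
  simp_rw [hw]
  refine sum_powerset_prod_le_one T w (fun t ht ω => ?_) (fun t ω r htr => ?_)
    fun t ht ω htω => ?_
  · have := hp t ht (armAt L B K x ω t)
    refine mul_nonneg ?_ (Real.exp_nonneg _)
    split_ifs <;> linarith
  · have h1 : (t ∈ insert r ω) ↔ t ∈ ω := by simp [htr.ne]
    simp only [w, armAt_insert L B K x htr.le (by omega), h1]
  · have ht1 := (Finset.mem_Icc.1 ht).1
    simp only [w, armAt_insert L B K x le_rfl ht1, Finset.mem_insert_self, if_true, htω, if_false]
    split_ifs with hcond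
    · obtain ⟨-, rfl⟩ := hcond
      have hq := hp t ht (armAt L B K x ω t)
      have h := bernoulli_exp_le hq.1 hq.2 l
      rw [Real.exp_sub, Real.exp_sub, mul_div_assoc', mul_div_assoc', ← add_div,
        div_le_one (Real.exp_pos _)]
      rw [zero_sub, mul_neg]
      exact h
    · simp

lemma sum_prob_le_one (hp : ∀ t ∈ Finset.Icc 1 T, ∀ i, 0 ≤ p t i ∧ p t i ≤ 1) :
    ∑ ω ∈ (Finset.Icc 1 T).powerset, prob L B K x p T ω ≤ 1 := by
  refine sum_powerset_prod_le_one T _ (fun t ht ω => ?_) (fun t ω r htr => ?_)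
    fun t ht ω htω => ?_
  · have := hp t ht (armAt L B K x ω t)
    split_ifs <;> linarith
  · have h1 : (t ∈ insert r ω) ↔ t ∈ ω := by simp [htr.ne]
    simp only [armAt_insert L B K x htr.le (by omega), h1]
  · have ht1 := (Finset.mem_Icc.1 ht).1
    simp [armAt_insert L B K x le_rfl ht1, htω]

/-- If the clicks are not concentrated, then one of the exponentials is large. -/
lemma exists_of_not_concentrated {ω : Finset ℕ} (hT : 2 ≤ T)
    (h : ¬ Concentrated p T (armAt L B K x ω) fun t => decide (t ∈ ω)) :
    ∃ i ∈ Finset.Icc 1 T ×ˢ Finset.Icc 1 T ×ˢ (Finset.univ : Finset (Fin n)) ×ˢ Finset.Icc 1 T,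
      ∃ l ∈ ({4 * rad T i.2.2.2, -(4 * rad T i.2.2.2)} : Set ℝ),
      (T : ℝ) ^ 8 ≤ Real.exp (l * deviation L B K x p i.1 (i.2.1 + 1) i.2.2.1 ω -
        l ^ 2 / 8 * playCount L B K x i.1 (i.2.1 + 1) i.2.2.1 ω) := by
  unfold Concentrated at h
  push Not at h
  obtain ⟨a, b, u, ha, hab, hb, h⟩ := h
  set click : ℕ → Bool := fun t => decide (t ∈ ω) with hclick
  set arm := armAt L B K x ω with harm
  have hN : playCount L B K x a b u ω = plays (segment arm click a b) u :=
    (plays_segment_eq_sum arm click hab u).symm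
  have hD : deviation L B K x p a b u ω = (clicks (segment arm click a b) u : ℝ) -
      ∑ r ∈ Finset.Ico a b, if arm r = u then p r u else 0 := by
    rw [clicks_segment_eq_sum arm click hab u, deviation]
    push_cast
    rw [← Finset.sum_sub_distrib]
    refine Finset.sum_congr rfl fun r _ => ?_
    by_cases h1 : armAt L B K x ω r = u <;> by_cases h2 : r ∈ ω <;> simp [harm, hclick, h1, h2]
  rw [← hN, ← hD] at h
  have hNle : playCount L B K x a b u ω ≤ b - a := hN ▸ plays_segment_le_length arm click u
  have hN0 : playCount L B K x a b u ω ≠ 0 := by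
    intro h0
    have hD0 : deviation L B K x p a b u ω = 0 := by
      refine Finset.sum_eq_zero fun r hr => ?_
      have := (Finset.sum_eq_zero_iff.1 h0) r hr
      rw [if_neg (by simpa using this)]
    rw [h0, hD0] at h
    simp at h
  have hs := rad_sq T (playCount L B K x a b u ω)
  have hr := rad_nonneg T (playCount L B K x a b u ω)
  obtain ⟨b, rfl⟩ : ∃ c, b = c + 1 := ⟨b - 1, by omega⟩
  -- The play count is random, while the supermartingale bound needs a fixed exponent; so its value
  -- becomes a further index of the union bound.
  refine ⟨(a, b, u, playCount L B K x a (b + 1) u ω), ?_, ?_⟩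
  · simp only [Finset.mem_product, Finset.mem_Icc, Finset.mem_univ, true_and]
    omega
  dsimp only
  generalize deviation L B K x p a (b + 1) u ω = D at *
  generalize playCount L B K x a (b + 1) u ω = m at *
  have hm : (1 : ℝ) ≤ m := by exact_mod_cast Nat.one_le_iff_ne_zero.2 hN0
  have hT8 : (T : ℝ) ^ 8 = Real.exp (8 * Real.log T) := by
    rw [mul_comm, Real.exp_mul, Real.exp_log (by positivity)]
    norm_cast
  rw [hT8]
  simp only [Real.exp_le_exp, Set.mem_insert_iff, Set.mem_singleton_iff, exists_eq_or_imp,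
    exists_eq_left]
  -- With l = ±4 `rad` and m plays the exponent is at least 4m `rad`² - 2m `rad`² = 2m `rad`² ≥ (1 +
  -- m) `rad`² = 8 log T, using m ≥ 1.
  rcases lt_abs.1 h with h | h
  · left
    nlinarith [mul_le_mul_of_nonneg_left h.le hr, sq_nonneg (rad T m)]
  · right
    nlinarith [mul_le_mul_of_nonneg_left h.le hr, sq_nonneg (rad T m)]

open Classical in
-- Markov's inequality and a union bound over nT³ choices of stretch, arm and play count, and two
-- signs of the exponent.
lemma sum_prob_not_concentrated_le (hp : ∀ t ∈ Finset.Icc 1 T, ∀ i, 0 ≤ p t i ∧ p t i ≤ 1)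
    (hT : 2 ≤ T) :
    (∑ ω ∈ (Finset.Icc 1 T).powerset,
      if Concentrated p T (armAt L B K x ω) (fun t => decide (t ∈ ω)) then 0
      else prob L B K x p T ω) * (T : ℝ) ^ 8 ≤ 2 * n * (T : ℝ) ^ 3 := by
  let I := Finset.Icc 1 T ×ˢ Finset.Icc 1 T ×ˢ (Finset.univ : Finset (Fin n)) ×ˢ Finset.Icc 1 T
  let E : ℝ → ℕ × ℕ × Fin n × ℕ → Finset ℕ → ℝ := fun l i ω =>
    Real.exp (l * deviation L B K x p i.1 (i.2.1 + 1) i.2.2.1 ω -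
        l ^ 2 / 8 * playCount L B K x i.1 (i.2.1 + 1) i.2.2.1 ω)
  calc _ ≤ ∑ ω ∈ (Finset.Icc 1 T).powerset, ∑ i ∈ I,
        (prob L B K x p T ω * E (4 * rad T i.2.2.2) i ω +
          prob L B K x p T ω * E (-(4 * rad T i.2.2.2)) i ω) := by
        rw [Finset.sum_mul]
        refine Finset.sum_le_sum fun ω _ => ?_
        have hP := prob_nonneg L B K x hp ω
        have hnn : ∀ i ∈ I, 0 ≤ prob L B K x p T ω * E (4 * rad T i.2.2.2) i ω +
            prob L B K x p T ω * E (-(4 * rad T i.2.2.2)) i ω := fun i _ => by positivity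
        split_ifs with h
        · rw [zero_mul]
          exact Finset.sum_nonneg hnn
        · obtain ⟨i, hi, l, hl, hle⟩ := exists_of_not_concentrated L B K x hT h
          refine le_trans ?_ (Finset.single_le_sum hnn hi)
          have h1 := mul_le_mul_of_nonneg_left hle hP
          rcases hl with rfl | rfl
          · exact h1.trans (le_add_of_nonneg_right (by positivity))
          · exact h1.trans (le_add_of_nonneg_left (by positivity))
    _ = ∑ i ∈ I, ∑ ω ∈ (Finset.Icc 1 T).powerset,
        (prob L B K x p T ω * E (4 * rad T i.2.2.2) i ω +
          prob L B K x p T ω * E (-(4 * rad T i.2.2.2)) i ω) := Finset.sum_comm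
    _ ≤ ∑ _i ∈ I, (2 : ℝ) := by
        refine Finset.sum_le_sum fun i hi => ?_
        simp only [I, Finset.mem_product, Finset.mem_Icc, Finset.mem_univ, true_and] at hi
        rw [Finset.sum_add_distrib]
        have h1 := sum_prob_mul_exp_le_one L B K x hp (a := i.1) (b := i.2.1 + 1) (by omega)
          (by omega) i.2.2.1
        linarith [h1 (4 * rad T i.2.2.2), h1 (-(4 * rad T i.2.2.2))]
    _ = _ := by simp [I]; ring

open Classical in
/-- The regret is governed by its bound on concentrated clicks. -/
lemma regret_le (hp : ∀ t ∈ Finset.Icc 1 T, ∀ i, 0 ≤ p t i ∧ p t i ≤ 1) (hT : 2 ≤ T)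
    {R : ℝ} (hR : 0 ≤ R)
    (h : ∀ ω, Concentrated p T (armAt L B K x ω) (fun t => decide (t ∈ ω)) →
      ∑ t ∈ Finset.Icc 1 T, (best p t - p t (armAt L B K x ω t)) ≤ R) (hn : n ≤ T) :
    regret L B K x p T ≤ R + 1 := by
  set Q := ∑ ω ∈ (Finset.Icc 1 T).powerset,
      if Concentrated p T (armAt L B K x ω) (fun t => decide (t ∈ ω)) then 0
      else prob L B K x p T ω with hQ
  have hT' : (2 : ℝ) ≤ T := by exact_mod_cast hT
  have hQT : T * Q ≤ 1 := by
    have h1 := sum_prob_not_concentrated_le L B K x hp hT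
    rw [← hQ] at h1
    have hn' : (n : ℝ) ≤ T := by exact_mod_cast hn
    have h2 : 2 * n * (T : ℝ) ^ 3 ≤ (T : ℝ) ^ 7 := by
      calc 2 * n * (T : ℝ) ^ 3 ≤ T * T * (T : ℝ) ^ 3 := by gcongr
        _ = (T : ℝ) ^ 5 := by ring
        _ ≤ (T : ℝ) ^ 7 := pow_le_pow_right₀ (by linarith) (by norm_num)
    have h3 : 0 < (T : ℝ) ^ 7 := by positivity
    nlinarith
  have hterm : ∀ ω, prob L B K x p T ω *
      ∑ t ∈ Finset.Icc 1 T, (best p t - p t (armAt L B K x ω t)) ≤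
      prob L B K x p T ω * R +
        T * if Concentrated p T (armAt L B K x ω) (fun t => decide (t ∈ ω)) then 0
          else prob L B K x p T ω := by
    intro ω
    have hP := prob_nonneg L B K x hp ω
    split_ifs with hc
    · rw [mul_zero, add_zero]
      exact mul_le_mul_of_nonneg_left (h ω hc) hP
    · have h1 : ∑ t ∈ Finset.Icc 1 T, (best p t - p t (armAt L B K x ω t)) ≤ T := by
        calc _ ≤ ∑ _t ∈ Finset.Icc 1 T, (1 : ℝ) := Finset.sum_le_sum fun t ht => by
              rw [Finset.mem_Icc] at ht
              exact best_sub_le_one hp ht.1 ht.2 _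
          _ = T := by simp
      nlinarith [mul_nonneg hP hR, mul_le_mul_of_nonneg_left h1 hP]
  calc regret L B K x p T ≤ ∑ ω ∈ (Finset.Icc 1 T).powerset, (prob L B K x p T ω * R +
        T * if Concentrated p T (armAt L B K x ω) (fun t => decide (t ∈ ω)) then 0
          else prob L B K x p T ω) := Finset.sum_le_sum fun ω _ => hterm ω
    _ = (∑ ω ∈ (Finset.Icc 1 T).powerset, prob L B K x p T ω) * R + T * Q := by
        rw [Finset.sum_add_distrib, ← Finset.sum_mul, ← Finset.mul_sum]
    _ ≤ 1 * R + 1 := by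
        gcongr
        exact sum_prob_le_one L B K x hp
    _ = R + 1 := by ring

/-- This trivial bound serves the case n > T, where T is below the n/Δ term. -/
lemma regret_le_length (hp : ∀ t ∈ Finset.Icc 1 T, ∀ i, 0 ≤ p t i ∧ p t i ≤ 1) :
    regret L B K x p T ≤ T := by
  calc regret L B K x p T ≤ ∑ ω ∈ (Finset.Icc 1 T).powerset, prob L B K x p T ω * T := by
        refine Finset.sum_le_sum fun ω _ =>
          mul_le_mul_of_nonneg_left ?_ (prob_nonneg L B K x hp ω)
        calc _ ≤ ∑ _t ∈ Finset.Icc 1 T, (1 : ℝ) := Finset.sum_le_sum fun t ht => by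
              rw [Finset.mem_Icc] at ht
              exact best_sub_le_one hp ht.1 ht.2 _
          _ = T := by simp
    _ ≤ 1 * T := by
        rw [← Finset.sum_mul]
        gcongr
        exact sum_prob_le_one L B K x hp
    _ = T := one_mul _

end Run

end EventfulBandit

/-! ### The regret bound -/

theorem mainTheorem2 :
    ∃ c₀ : ℝ, 0 < c₀ ∧ ∀ c₁ : ℝ, c₀ ≤ c₁ → ∃ C : ℝ, 0 < C ∧
      ∀ (X : Type u) (F : Set (X → EventfulBandit.Value)) (n T k d L : ℕ) (ε Δ : ℝ)
        (p : ℕ → Fin n → ℝ) (x : ℕ → X) (tie : ℕ → EventfulBandit.TieBreak n),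
        2 ≤ T →
        (∀ t ∈ Finset.Icc 1 T, ∀ i, 0 ≤ p t i ∧ p t i ≤ 1) →
        (∃ f ∈ F, EventfulBandit.IsEventOracle p x T f) →
        (EventfulBandit.events p T).card = k →
        0 < ε → EventfulBandit.HasMinShift p T ε →
        0 < Δ → EventfulBandit.HasMinSubopt p T Δ →
        EventfulBandit.diameter F = (d : ℕ∞) → 1 ≤ d →
        c₀ * ((n : ℝ) / ε ^ 2 * Real.log T) ≤ (L : ℝ) →
        (L : ℝ) ≤ c₁ * ((n : ℝ) / ε ^ 2 * Real.log T) →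
        EventfulBandit.EventsApart p T (2 * L) →
        EventfulBandit.regret L (fun s => EventfulBandit.ucb T ε (tie s))
            (EventfulBandit.safeCl F) x p T ≤
          C * (((3 * (k : ℝ) + 2 * d) * (n / Δ) + k * (n / ε ^ 2)) * Real.log T) := by
  refine ⟨30000000, by norm_num, fun c₁ hc₁ => ⟨3000 + c₁, by linarith, ?_⟩⟩
  intro X F n T k d L ε Δ p x tie hT hp hF hk hε hshift hΔ hsub hd hd1 hL hL' hap
  obtain ⟨f₀, hf₀, horacle⟩ := hF
  -- A tie-breaking rule returns an arm even for the empty set, so some arm exists.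
  have hn : 0 < n := Fin.pos ((tie 0).arm [] ∅)
  have hn1 : (1 : ℝ) ≤ n := by exact_mod_cast hn
  have hl := EventfulBandit.half_lt_log hT
  have hd1' : (1 : ℝ) ≤ d := by exact_mod_cast hd1
  have hk0 : (0 : ℝ) ≤ k := Nat.cast_nonneg k
  have hLpos : 1 ≤ L := by
    have : (0 : ℝ) < L := lt_of_lt_of_le (by positivity) hL
    exact_mod_cast this
  have hx : 0 ≤ n / Δ * Real.log T := by positivity
  have hy : 0 ≤ n / ε ^ 2 * Real.log T := by positivity
  have hC : 3000 * ((3 * k + 2 * d) * (n / Δ * Real.log T)) + c₁ * (k * (n / ε ^ 2 * Real.log T)) ≤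
      (3000 + c₁) * (((3 * (k : ℝ) + 2 * d) * (n / Δ) + k * (n / ε ^ 2)) * Real.log T) := by
    have h1 : 0 ≤ c₁ * ((3 * k + 2 * d) * (n / Δ * Real.log T)) :=
      mul_nonneg (by linarith) (by positivity)
    have h2 : 0 ≤ k * (n / ε ^ 2 * Real.log T) := by positivity
    linarith
  refine le_trans ?_ hC
  have hcy : 0 ≤ c₁ * (k * (n / ε ^ 2 * Real.log T)) := mul_nonneg (by linarith) (by positivity)
  -- If no arm is ever suboptimal, Δ may be arbitrarily large and the n/Δ term is no help, but the
  -- regret vanishes. Otherwise Δ ≤ 1, so n is at most 2 (n/Δ) log T, which absorbs additive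
  -- constants.
  by_cases hopt : ∀ t ∈ Finset.Icc 1 T, ∀ i, p t i = EventfulBandit.best p t
  · have h0 : EventfulBandit.regret L (fun s => EventfulBandit.ucb T ε (tie s))
        (EventfulBandit.safeCl F) x p T = 0 := by
      refine Finset.sum_eq_zero fun ω _ => ?_
      rw [Finset.sum_eq_zero fun t ht => sub_eq_zero.2 (hopt t ht _).symm, mul_zero]
    rw [h0]
    positivity
  push Not at hopt
  obtain ⟨t, ht, i, hti⟩ := hopt
  have hΔ1 : Δ ≤ 1 := by
    have h1 := hsub t ht i (lt_of_le_of_ne (EventfulBandit.le_best t i) hti)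
    rw [Finset.mem_Icc] at ht
    exact h1.trans (EventfulBandit.best_sub_le_one hp ht.1 ht.2 i)
  have hnΔ : (n : ℝ) ≤ n / Δ := by
    rw [le_div_iff₀ hΔ]
    exact mul_le_of_le_one_right (by linarith) hΔ1
  have hnx : (n : ℝ) ≤ 2 * (n / Δ * Real.log T) := by nlinarith
  have hdx : n / Δ * Real.log T ≤ d * (n / Δ * Real.log T) := le_mul_of_one_le_left hx hd1'
  have hkx : 0 ≤ k * (n / Δ * Real.log T) := by positivity
  rcases le_or_gt n T with hnT | hnT
  · have H : EventfulBandit.Admissible T L ε Δ p x f₀ :=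
      ⟨hT, hp, horacle, hε, hshift, hΔ, hsub, hLpos, hL, hap⟩
    have hA := H.phaseRegret_nonneg
    have h1 := EventfulBandit.regret_le L (fun s => EventfulBandit.ucb T ε (tie s))
      (EventfulBandit.safeCl F) x hp hT (by positivity)
      (fun ω hc => EventfulBandit.sum_gap_le_of_concentrated H hf₀ hd ω hc) hnT
    rw [hk, EventfulBandit.phaseRegret] at h1
    have h2 := mul_le_mul_of_nonneg_right hL' hk0
    linarith
  · have h1 := EventfulBandit.regret_le_length L (fun s => EventfulBandit.ucb T ε (tie s))
      (EventfulBandit.safeCl F) x hp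
    have h2 : (T : ℝ) ≤ n := by exact_mod_cast hnT.le
    linarith
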